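/- Let $\hat{\mathbb H}^3$ be the metric completion of the universal cover of $\mathbb H^3\setminus\sigma$, where $\sigma$ is a bi-infinite geodesic, with cylindrical coordinates $(r,\zeta,\theta)$, $r\ge 0$, $\zeta,\theta\in\mathbb R$ (where $\theta$ is immaterial when $r=0$), and path metric given by $ds^2=dr^2+\cosh^2 r\,d\zeta^2+\sinh^2 r\,d\theta^2$. The additive group $\mathbb C$ acts on it by isometries, $z\cdot(r,\zeta,\theta)=(r,\zeta+\operatorname{Re}z,\theta+\operatorname{Im}z)$; the isometry given by $z$ is called loxodromic if $\operatorname{Re}z\neq 0$, and $\operatorname{Im}z$ is its rotational part. For $\alpha,\lambda>0$ and $\tau\in\mathbb R$, let $G\subset\mathbb C$ be the group generated by $i\alpha$ and $\lambda+i\tau$. The model solid torus is $N=N_{\alpha,\lambda,\tau}=\hat{\mathbb H}^3/G$ with the quotient metric; its core $\Sigma$ is the image of $\{r=0\}$. (For $\alpha=2\pi$ this is the nonsingular tube $\mathbb H^3/\langle\varphi\rangle$, where $\varphi$ is a loxodromic isometry of complex length $\lambda+i\tau$.) For $x\in N$ let $\operatorname{injrad}(x)$ be the supremum of the radii $s>0$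 such that the open $s$-ball about $x$ is isometric, in the Riemannian sense (by a bijective local isometry that takes center to center), to an open $s$-ball in $\mathbb H^3$; if $\alpha\ne2\pi$ and $x\in\Sigma$, put $\operatorname{injrad}(x)=0$. For $\epsilon>0$ let $N^{\le\epsilon}=\{x\in N:\operatorname{injrad}(x)\le\epsilon/2\}$ and $T^\epsilon=\{x\in N:\operatorname{injrad}(x)=\epsilon/2\}$. An element $\eta\in G$ realizes the injectivity radius of $T^\epsilon$ if $d(\tilde x,\eta\tilde x)=2\operatorname{injrad}(x)=\epsilon$ for every $x\in T^\epsilon$ and every lift $\tilde x\in\hat{\mathbb H}^3$ of $x$. Suppose $0<\delta<\epsilon$, $0<\alpha\le2\pi$, $\lambda>0$, $\tau\in\mathbb R$, and $N^{\le\delta}\neq\emptyset$. Then $T^\delta$ and $T^\epsilon$ are each nonempty and equal to the set of all points of $N$ at a fixed distance from $\Sigma$, denoted $r(\delta)$ and $r(\epsilon)$ respectively, and $$\frac{\cosh r(\epsilon)}{\cosh r(\delta)}\le\sqrt{\frac{\cosh\epsilon-1}{\cosh\delta-1}}.$$ Equality holds if and only if the injectivity radii of $T^\delta$ and $T^\epsilon$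 are realized by the same loxodromic element $\eta\in G$, and this $\eta$ has trivial rotational part $\operatorname{Im}\eta=0$. In particular, if $\alpha=2\pi$ and $\tau=0$, then equality holds. -/

import Mathlib

namespace ModelTube

noncomputable section

/-! ### Hyperbolic 3-space (hyperboloid model) -/

/-- The Minkowski form `-x₀y₀ + x₁y₁ + x₂y₂ + x₃y₃` on `ℝ⁴`. -/
def minkowski (x y : Fin 4 → ℝ) : ℝ :=
  -(x 0 * y 0) + x 1 * y 1 + x 2 * y 2 + x 3 * y 3

/-- Hyperbolic 3-space as the upper sheet of the hyperboloid. -/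
def H3 : Type := {x : Fin 4 → ℝ // minkowski x x = -1 ∧ 0 < x 0}

/-- Hyperbolic distance, `cosh d(p,q) = -⟨p,q⟩`. -/
def H3.dist (p q : H3) : ℝ := Real.arcosh (-minkowski p.1 q.1)

/-- The base point `0 ∈ ℍ³`. -/
def H3.origin : H3 :=
  ⟨![1, 0, 0, 0], by simp [minkowski], by simp⟩

/-- Open metric balls of `ℍ³`. -/
def H3.ball (p : H3) (s : ℝ) : Set H3 := {q | H3.dist p q < s}

/-! ### The infinite cyclic branched cover of `ℍ³` along a geodesic -/

/-- Cylindrical coordinates `(r, ζ, θ)` with `r ≥ 0`; the angle is real-valued. -/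
structure Cyl where
  r : ℝ
  zeta : ℝ
  theta : ℝ
  r_nonneg : 0 ≤ r

/-- Two coordinate triples name the same point if they agree, except that the angle is
immaterial on the singular geodesic `r = 0`. -/
def cylSetoid : Setoid Cyl where
  r p q := p.r = q.r ∧ p.zeta = q.zeta ∧ (p.r = 0 ∨ p.theta = q.theta)
  iseqv :=
    { refl := fun _ => ⟨rfl, rfl, Or.inr rfl⟩
      symm := by
        rintro p q ⟨h1, h2, h3⟩
        refine ⟨h1.symm, h2.symm, ?_⟩
        rcases h3 with h3 | h3
        · exact Or.inl (h1 ▸ h3)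
        · exact Or.inr h3.symm
      trans := by
        rintro p q s ⟨h1, h2, h3⟩ ⟨k1, k2, k3⟩
        refine ⟨h1.trans k1, h2.trans k2, ?_⟩
        rcases h3 with h3 | h3
        · exact Or.inl h3
        · rcases k3 with k3 | k3
          · exact Or.inl (h1.trans k3)
          · exact Or.inr (h3.trans k3) }

/-- The space `Ĥ³`, in cylindrical coordinates. The points with `r > 0` form the universal cover
of `ℍ³` minus a geodesic; the points with `r = 0` are the ones added in the metric completion. -/
def HatH3 : Type := Quotient cylSetoid

/-- The point of `Ĥ³` with given cylindrical coordinates. -/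
def HatH3.mk (p : Cyl) : HatH3 := Quotient.mk cylSetoid p

/-- The distance of a point of `Ĥ³` from the singular geodesic (its coordinate `r`). -/
def HatH3.radius (x : HatH3) : ℝ :=
  Quotient.lift (s := cylSetoid) Cyl.r (fun _ _ h => h.1) x

/-- A `C¹` curve in cylindrical coordinates, parametrized by `[0,1]`. (The speed may vanish, so
piecewise `C¹` curves can be reparametrized to be of this form.) -/
structure CylCurve where
  r : ℝ → ℝ
  zeta : ℝ → ℝ
  theta : ℝ → ℝ
  r_smooth : ContDiff ℝ 1 r
  zeta_smooth : ContDiff ℝ 1 zeta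
  theta_smooth : ContDiff ℝ 1 theta
  r_nonneg : ∀ t ∈ Set.Icc (0 : ℝ) 1, 0 ≤ r t

/-- The length of a curve for `ds² = dr² + cosh² r dζ² + sinh² r dθ²`. -/
def CylCurve.length (c : CylCurve) : ℝ :=
  ∫ t in (0 : ℝ)..1,
    Real.sqrt ((deriv c.r t) ^ 2 + (Real.cosh (c.r t)) ^ 2 * (deriv c.zeta t) ^ 2
      + (Real.sinh (c.r t)) ^ 2 * (deriv c.theta t) ^ 2)

/-- The initial point of a curve. -/
def CylCurve.source (c : CylCurve) : HatH3 :=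
  HatH3.mk ⟨c.r 0, c.zeta 0, c.theta 0, c.r_nonneg 0 (by simp)⟩

/-- The terminal point of a curve. -/
def CylCurve.target (c : CylCurve) : HatH3 :=
  HatH3.mk ⟨c.r 1, c.zeta 1, c.theta 1, c.r_nonneg 1 (by simp)⟩

/-- The path metric of `Ĥ³`: the infimum of the lengths of curves joining two points. -/
def HatH3.dist (x y : HatH3) : ℝ :=
  sInf {L : ℝ | ∃ c : CylCurve, c.source = x ∧ c.target = y ∧ L = c.length}

/-- The action of `ℂ` on coordinates: `z` translates by `Re z` and rotates by `Im z`. -/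
def Cyl.shift (z : ℂ) (p : Cyl) : Cyl := ⟨p.r, z.re + p.zeta, z.im + p.theta, p.r_nonneg⟩

/-- The action of the additive group `ℂ` on `Ĥ³`; `z +ᵥ x` is the image of `x` under the
isometry of complex length `z`. -/
instance : AddAction ℂ HatH3 where
  vadd z x := Quotient.map (sa := cylSetoid) (sb := cylSetoid) (Cyl.shift z)
    (by
      rintro p q ⟨h1, h2, h3⟩
      refine ⟨h1, ?_, ?_⟩
      · simp [Cyl.shift, h2]
      · rcases h3 with h3 | h3
        · exact Or.inl h3
        · exact Or.inr (by simp [Cyl.shift, h3])) x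
  zero_vadd x := by
    induction x using Quotient.inductionOn with
    | h p =>
      apply Quotient.sound (s := cylSetoid)
      exact ⟨rfl, by simp [Cyl.shift], Or.inr (by simp [Cyl.shift])⟩
  add_vadd z w x := by
    induction x using Quotient.inductionOn with
    | h p =>
      apply Quotient.sound (s := cylSetoid)
      exact ⟨rfl, by simp [Cyl.shift, add_assoc], Or.inr (by simp [Cyl.shift, add_assoc])⟩

/-! ### Model solid tori -/

/-- The group generated by the elliptic of complex length `iα` and the loxodromic of complex
length `l + iτ`. -/
def deckGroup (α l τ : ℝ) : AddSubgroup ℂ :=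
  AddSubgroup.closure {(⟨0, α⟩ : ℂ), (⟨l, τ⟩ : ℂ)}

/-- The model solid torus with cone angle `α` and core of complex length `l + iτ`. -/
def SolidTorus (α l τ : ℝ) : Type :=
  Quotient (AddAction.orbitRel (deckGroup α l τ) HatH3)

namespace SolidTorus

variable {α l τ : ℝ}

/-- The quotient map `Ĥ³ → N`. -/
def proj (α l τ : ℝ) (x : HatH3) : SolidTorus α l τ :=
  Quotient.mk (AddAction.orbitRel (deckGroup α l τ) HatH3) x

/-- The quotient metric: the smallest distance between lifts. -/
def dist (x y : SolidTorus α l τ) : ℝ :=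
  sInf {d : ℝ | ∃ a b : HatH3, proj α l τ a = x ∧ proj α l τ b = y ∧ d = HatH3.dist a b}

/-- Open metric balls of `N`. -/
def ball (x : SolidTorus α l τ) (s : ℝ) : Set (SolidTorus α l τ) := {y | dist x y < s}

lemma radius_vadd (z : ℂ) (x : HatH3) : (z +ᵥ x).radius = x.radius := by
  induction x using Quotient.inductionOn with
  | h p => rfl

/-- The distance of a point of `N` from the core geodesic. -/
def radius (x : SolidTorus α l τ) : ℝ :=
  Quotient.lift (s := AddAction.orbitRel (deckGroup α l τ) HatH3) HatH3.radius
    (by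
      rintro a b ⟨g, rfl⟩
      exact radius_vadd (g : ℂ) b) x

/-- The open `s`-ball about `x` is isometric to the `s`-ball about the base point of `ℍ³`, in the
sense of Riemannian geometry: there is a bijection between the balls which takes center to center
and which maps a small metric ball around each point isometrically onto the metric ball of the same
radius around the image point. -/
def IsEmbeddedBall (x : SolidTorus α l τ) (s : ℝ) : Prop :=
  ∃ f : H3 → SolidTorus α l τ,
    f H3.origin = x ∧
    Set.BijOn f (H3.ball H3.origin s) (ball x s) ∧
    ∀ p ∈ H3.ball H3.origin s, ∃ t : ℝ, 0 < t ∧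
      H3.ball p t ⊆ H3.ball H3.origin s ∧
      f '' H3.ball p t = ball (f p) t ∧
      ∀ q ∈ H3.ball p t, ∀ q' ∈ H3.ball p t, dist (f q) (f q') = H3.dist q q'

open Classical in
/-- The injectivity radius, set to `0` on a singular core. -/
def injrad (x : SolidTorus α l τ) : ℝ :=
  if α ≠ 2 * Real.pi ∧ x.radius = 0 then 0
  else sSup {s : ℝ | 0 < s ∧ x.IsEmbeddedBall s}

end SolidTorus

open SolidTorus

/-- The thin part `N^{≤ ε}`, the points of injectivity radius at most `ε / 2`. -/
def thinPart (α l τ ε : ℝ) : Set (SolidTorus α l τ) := {x | x.injrad ≤ ε / 2}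

/-- The torus `T^ε`, the points of injectivity radius exactly `ε / 2`. -/
def thinTorus (α l τ ε : ℝ) : Set (SolidTorus α l τ) := {x | x.injrad = ε / 2}

/-- The equidistant torus `T_ρ` at distance `ρ` from the core. -/
def equidistantTorus (α l τ ρ : ℝ) : Set (SolidTorus α l τ) := {x | x.radius = ρ}

/-- The tube radius `r_{α,l,τ}(ε)`: the (common) distance of the points of `T^ε` from the core. -/
def tubeRadius (α l τ ε : ℝ) : ℝ := sSup (SolidTorus.radius '' thinTorus α l τ ε)

/-- The isometry of `Ĥ³` of complex length `η` realizes the injectivity radius of every point of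
`S`: it moves each lift `x̃` of a point `x` of `S` by the distance `2 injrad x`. -/
def RealizesInjrad (α l τ : ℝ) (η : ℂ) (S : Set (SolidTorus α l τ)) : Prop :=
  ∀ a : HatH3, proj α l τ a ∈ S →
    HatH3.dist a (η +ᵥ a) = 2 * (proj α l τ a).injrad

/-- An isometry of `Ĥ³` of complex length `η` is loxodromic if it translates the singular
geodesic by a nonzero distance. -/
def IsLoxodromic (η : ℂ) : Prop := η.re ≠ 0

/-- Its rotational part, `Im η`, is trivial. -/
def HasTrivialRotation (η : ℂ) : Prop := η.im = 0

end

end ModelTube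

namespace ModelTube
noncomputable section

/-! ### Geometry of the hyperboloid -/

/-! At distance `r` from the core, the isometry `η` moves points by `d` with `cosh d = X (cosh (Re
η) - c) + c`, where `X = cosh² r` and `c = cos (min |Im η| π)` (`Hat.cosh_dist_vadd`). For `η ≠ 0`
this is affine and strictly increasing in `X`. Twice the injectivity radius is the least
displacement over the effective elements of the group (`isEmbeddedBall_iff`), so it depends only on
`r` and increases with it. Each nonempty `T^δ` is therefore an equidistant torus, on which the least
displacement is attained and equals `δ` (`exists_radius`).

For the inequality, let `η` realize `ε` at radius `r(ε)`. At `r(δ)` it still displaces by at least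
`δ`. Since the slope is the same at both radii, `cosh² r(ε) / cosh² r(δ) ≤ (cosh ε - c) / (cosh δ -
c)`, and `c ≤ 1` together with `δ < ε` bounds this by the same quotient with `c = 1`. Equality
forces `c = 1`, that is `Im η = 0`, and forces `η` to realize `δ` as well.

Most of the work is to identify the injectivity radius, which is defined by Riemannian isometries of
balls, with half the least displacement. This needs the explicit distance on `Ĥ³` (`Hat.dist_mk`):
as in `ℍ³` for angles up to `π`, and through the core beyond that. If displacements are at least
`2s`, the `s`-ball upstairs projects to an embedded ball (`IsMetricQuotient.isEmbeddedBall`).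
Conversely, a geodesic from `x` to `η x` shorter than `2s` would project to a loop inside the
embedded ball, and hence give a locally geodesic loop in `ℍ³`; convexity of `cosh d` excludes it
(`Hyp.no_geodesic_loop`, `IsMetricQuotient.le_of_isEmbeddedBall`). This argument runs in `Ĥ³` for `α
< 2π`, where embedded balls must also be kept off the core (`le_radius_of_isEmbeddedBall`), and in
`ℍ³` itself for `α = 2π`. -/

lemma minkowski_comm (x y : Fin 4 → ℝ) : minkowski x y = minkowski y x := by
  unfold minkowski; ring

lemma minkowski_add_left (x y z : Fin 4 → ℝ) :
    minkowski (x + y) z = minkowski x z + minkowski y z := by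
  simp only [minkowski, Pi.add_apply]; ring

lemma minkowski_smul_left (a : ℝ) (x z : Fin 4 → ℝ) :
    minkowski (a • x) z = a * minkowski x z := by
  simp only [minkowski, Pi.smul_apply, smul_eq_mul]; ring

lemma minkowski_add_right (x y z : Fin 4 → ℝ) :
    minkowski z (x + y) = minkowski z x + minkowski z y := by
  simp only [minkowski, Pi.add_apply]; ring

lemma minkowski_smul_right (a : ℝ) (x z : Fin 4 → ℝ) :
    minkowski z (a • x) = a * minkowski z x := by
  simp only [minkowski, Pi.smul_apply, smul_eq_mul]; ring

/-- Euclidean Cauchy–Schwarz on the last three coordinates, combined with `y₀² = 1 + |y'|²`: the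
complement of a timelike vector is spacelike. -/
lemma spatial_le_of_orthogonal {y w : Fin 4 → ℝ} (hy : minkowski y y = -1)
    (h : minkowski w y = 0) :
    w 0 ^ 2 ≤ w 1 ^ 2 + w 2 ^ 2 + w 3 ^ 2 ∧
      (minkowski w w = 0 → w 0 = 0) := by
  simp only [minkowski] at *
  have hcs : (w 0 * y 0) ^ 2 ≤
      (w 1 ^ 2 + w 2 ^ 2 + w 3 ^ 2) * (y 1 ^ 2 + y 2 ^ 2 + y 3 ^ 2) := by
    have : w 0 * y 0 = w 1 * y 1 + w 2 * y 2 + w 3 * y 3 := by linarith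
    rw [this]
    nlinarith [sq_nonneg (w 1 * y 2 - w 2 * y 1), sq_nonneg (w 1 * y 3 - w 3 * y 1),
      sq_nonneg (w 2 * y 3 - w 3 * y 2)]
  have hy0 : y 0 ^ 2 = 1 + (y 1 ^ 2 + y 2 ^ 2 + y 3 ^ 2) := by linarith
  rw [mul_pow, hy0] at hcs
  have hb : 0 ≤ y 1 ^ 2 + y 2 ^ 2 + y 3 ^ 2 := by positivity
  generalize y 1 ^ 2 + y 2 ^ 2 + y 3 ^ 2 = b at *
  constructor
  · by_contra hlt
    push Not at hlt
    have := mul_le_mul_of_nonneg_right hlt.le hb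
    have h0 : 0 ≤ w 1 ^ 2 + w 2 ^ 2 + w 3 ^ 2 := by positivity
    nlinarith
  · intro hw
    have e : w 1 ^ 2 + w 2 ^ 2 + w 3 ^ 2 = w 0 ^ 2 := by linarith
    rw [e] at hcs
    have : w 0 ^ 2 ≤ 0 := by linarith
    nlinarith [sq_nonneg (w 0)]

lemma minkowski_self_nonneg_of_orthogonal {y w : Fin 4 → ℝ} (hy : minkowski y y = -1)
    (h : minkowski w y = 0) : 0 ≤ minkowski w w := by
  have := (spatial_le_of_orthogonal hy h).1
  simp only [minkowski]; nlinarith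

lemma eq_zero_of_orthogonal_of_null {y w : Fin 4 → ℝ} (hy : minkowski y y = -1)
    (h : minkowski w y = 0) (hw : minkowski w w = 0) : w = 0 := by
  have h0 := (spatial_le_of_orthogonal hy h).2 hw
  simp only [minkowski, h0] at hw
  have h1 : w 1 = 0 := by nlinarith [sq_nonneg (w 1), sq_nonneg (w 2), sq_nonneg (w 3)]
  have h2 : w 2 = 0 := by nlinarith [sq_nonneg (w 1), sq_nonneg (w 2), sq_nonneg (w 3)]
  have h3 : w 3 = 0 := by nlinarith [sq_nonneg (w 1), sq_nonneg (w 2), sq_nonneg (w 3)]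
  funext i
  fin_cases i <;> simp [*]

/-- The form is positive semidefinite on the complement of `y`, so the quadratic `t ↦ ⟨v + t w, v +
t w⟩` has nonpositive discriminant. -/
lemma minkowski_cauchy_schwarz {y v w : Fin 4 → ℝ} (hy : minkowski y y = -1)
    (hv : minkowski v y = 0) (hw : minkowski w y = 0) :
    minkowski v w ^ 2 ≤ minkowski v v * minkowski w w := by
  have key : ∀ t : ℝ, 0 ≤ minkowski w w * (t * t) + 2 * minkowski v w * t + minkowski v v := by
    intro t
    have h0 : minkowski (v + t • w) y = 0 := by
      rw [minkowski_add_left, minkowski_smul_left, hv, hw]; ring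
    have := minkowski_self_nonneg_of_orthogonal hy h0
    rw [minkowski_add_left, minkowski_smul_left, minkowski_add_right, minkowski_add_right,
      minkowski_smul_right, minkowski_smul_right, minkowski_comm w v] at this
    linarith
  have := discrim_le_zero key
  unfold discrim at this
  nlinarith

lemma neg_minkowski_pos {x y : Fin 4 → ℝ} (hx : minkowski x x < 0) (hx0 : 0 < x 0)
    (hy : minkowski y y < 0) (hy0 : 0 < y 0) : 0 < -minkowski x y := by
  simp only [minkowski] at *
  have hcs : (x 1 * y 1 + x 2 * y 2 + x 3 * y 3) ^ 2 ≤
      (x 1 ^ 2 + x 2 ^ 2 + x 3 ^ 2) * (y 1 ^ 2 + y 2 ^ 2 + y 3 ^ 2) := by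
    nlinarith [sq_nonneg (x 1 * y 2 - x 2 * y 1), sq_nonneg (x 1 * y 3 - x 3 * y 1),
      sq_nonneg (x 2 * y 3 - x 3 * y 2)]
  have h1 : (x 1 ^ 2 + x 2 ^ 2 + x 3 ^ 2) * (y 1 ^ 2 + y 2 ^ 2 + y 3 ^ 2) <
      (x 0 * x 0) * (y 0 * y 0) := by
    apply mul_lt_mul'' <;> first | positivity | linarith
  have h2 := abs_lt_of_sq_lt_sq (a := x 1 * y 1 + x 2 * y 2 + x 3 * y 3) (b := x 0 * y 0)
    (by nlinarith) (by positivity)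
  linarith [(abs_lt.1 h2).2]

/-- The component of `q` orthogonal to `p` has square `⟨p,q⟩² - 1`, which is nonnegative. -/
lemma H3.one_le (p q : H3) : 1 ≤ -minkowski p.1 q.1 := by
  have h0 : 0 < -minkowski p.1 q.1 :=
    neg_minkowski_pos (by rw [p.2.1]; norm_num) p.2.2 (by rw [q.2.1]; norm_num) q.2.2
  have h1 : minkowski (q.1 + minkowski p.1 q.1 • p.1) p.1 = 0 := by
    rw [minkowski_add_left, minkowski_smul_left, p.2.1, minkowski_comm]; ring
  have h2 := minkowski_self_nonneg_of_orthogonal p.2.1 h1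
  rw [minkowski_add_left, minkowski_smul_left, minkowski_add_right, minkowski_add_right,
    minkowski_smul_right, minkowski_smul_right, p.2.1, q.2.1, minkowski_comm q.1 p.1] at h2
  nlinarith

lemma H3.cosh_dist (p q : H3) : Real.cosh (H3.dist p q) = -minkowski p.1 q.1 :=
  Real.cosh_arcosh (H3.one_le p q)

lemma H3.dist_nonneg (p q : H3) : 0 ≤ H3.dist p q := Real.arcosh_nonneg (H3.one_le p q)

lemma H3.dist_comm (p q : H3) : H3.dist p q = H3.dist q p := by
  unfold H3.dist; rw [minkowski_comm]

lemma H3.dist_self (p : H3) : H3.dist p p = 0 := by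
  unfold H3.dist; rw [p.2.1]; simp

lemma H3.eq_of_dist_eq_zero {p q : H3} (h : H3.dist p q = 0) : p = q := by
  have hA : -minkowski p.1 q.1 = 1 := (Real.arcosh_eq_zero_iff (H3.one_le p q)).1 h
  have hA' : minkowski p.1 q.1 = -1 := by linarith
  have h1 : minkowski (q.1 + (-1 : ℝ) • p.1) p.1 = 0 := by
    rw [minkowski_add_left, minkowski_smul_left, p.2.1, minkowski_comm, hA']; ring
  have h2 : minkowski (q.1 + (-1 : ℝ) • p.1) (q.1 + (-1 : ℝ) • p.1) = 0 := by
    rw [minkowski_add_left, minkowski_smul_left, minkowski_add_right, minkowski_add_right,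
      minkowski_smul_right, minkowski_smul_right, p.2.1, q.2.1, minkowski_comm q.1 p.1, hA']
    ring
  have := eq_zero_of_orthogonal_of_null p.2.1 h1 h2
  apply Subtype.ext
  rw [neg_one_smul, ← sub_eq_add_neg, sub_eq_zero] at this
  exact this.symm

/-- The components of `x` and `z` orthogonal to `y` have norms `sinh d(x,y)` and `sinh d(y,z)`.
Cauchy–Schwarz for them bounds `cosh d(x,z)` by the addition formula. -/
lemma H3.dist_triangle (x y z : H3) : H3.dist x z ≤ H3.dist x y + H3.dist y z := by
  have hsum := add_nonneg (H3.dist_nonneg x y) (H3.dist_nonneg y z)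
  rw [← abs_of_nonneg (H3.dist_nonneg x z), ← abs_of_nonneg hsum, ← Real.cosh_le_cosh,
    Real.cosh_add, H3.cosh_dist, H3.cosh_dist, H3.cosh_dist]
  have hs1 : Real.sinh (H3.dist x y) ^ 2 = minkowski x.1 y.1 ^ 2 - 1 := by
    rw [Real.sinh_sq, H3.cosh_dist]; ring
  have hs2 : Real.sinh (H3.dist y z) ^ 2 = minkowski y.1 z.1 ^ 2 - 1 := by
    rw [Real.sinh_sq, H3.cosh_dist]; ring
  have h1 : minkowski (x.1 + minkowski x.1 y.1 • y.1) y.1 = 0 := by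
    rw [minkowski_add_left, minkowski_smul_left, y.2.1]; ring
  have h2 : minkowski (z.1 + minkowski y.1 z.1 • y.1) y.1 = 0 := by
    rw [minkowski_add_left, minkowski_smul_left, y.2.1, minkowski_comm z.1 y.1]; ring
  have h3 := minkowski_cauchy_schwarz y.2.1 h1 h2
  simp only [minkowski_add_left, minkowski_smul_left, minkowski_add_right,
    minkowski_smul_right, x.2.1, y.2.1, z.2.1, minkowski_comm z.1 y.1,
    minkowski_comm y.1 x.1] at h3
  have h4 : (minkowski x.1 z.1 + minkowski x.1 y.1 * minkowski y.1 z.1) ^ 2 ≤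
      (Real.sinh (H3.dist x y) * Real.sinh (H3.dist y z)) ^ 2 := by
    rw [mul_pow, hs1, hs2]; nlinarith
  have h5 := abs_le_of_sq_le_sq h4 (mul_nonneg (Real.sinh_nonneg_iff.2 (H3.dist_nonneg x y))
    (Real.sinh_nonneg_iff.2 (H3.dist_nonneg y z)))
  linarith [(abs_le.1 h5).1]

/-! ### Geodesics and symmetries of `ℍ³` -/

instance : MetricSpace H3 where
  dist := H3.dist
  dist_self := H3.dist_self
  dist_comm := H3.dist_comm
  dist_triangle := H3.dist_triangle
  eq_of_dist_eq_zero := H3.eq_of_dist_eq_zero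

lemma Hyp.dist_def (p q : H3) : dist p q = H3.dist p q := rfl

lemma Hyp.dist_eq_of_minkowski {p q p' q' : H3} (h : minkowski p.1 q.1 = minkowski p'.1 q'.1) :
    dist p q = dist p' q' := by
  simp only [Hyp.dist_def, H3.dist, h]

lemma Hyp.dist_eq_of_cosh {p q : H3} {d : ℝ} (hd : 0 ≤ d) (h : -minkowski p.1 q.1 = Real.cosh d) :
    dist p q = d := by
  rw [Hyp.dist_def, H3.dist, h, Real.arcosh_cosh hd]

/-- The point at time `t` on the geodesic starting at `p` with unit velocity `e`. -/
def Hyp.geo (p : H3) (e : Fin 4 → ℝ) (he : minkowski e e = 1) (hpe : minkowski p.1 e = 0)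
    (t : ℝ) : H3 :=
  ⟨Real.cosh t • p.1 + Real.sinh t • e, by
    have h1 : minkowski (Real.cosh t • p.1 + Real.sinh t • e)
        (Real.cosh t • p.1 + Real.sinh t • e) = -1 := by
      simp only [minkowski_add_left, minkowski_smul_left, minkowski_add_right,
        minkowski_smul_right, p.2.1, he, hpe, minkowski_comm e p.1]
      nlinarith [Real.cosh_sq t]
    refine ⟨h1, ?_⟩
    have h2 : minkowski (Real.cosh t • p.1 + Real.sinh t • e) p.1 = -Real.cosh t := by
      simp only [minkowski_add_left, minkowski_smul_left, p.2.1, hpe, minkowski_comm e p.1]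
      ring
    generalize hq : Real.cosh t • p.1 + Real.sinh t • e = q at *
    -- Otherwise `-q` lies in the future cone along with `p`, so `⟨q, p⟩ > 0`, against `⟨q, p⟩ =
    -- -cosh t`.
    by_contra hneg
    push Not at hneg
    have hq0 : 0 < (-q) 0 := by
      rcases hneg.lt_or_eq with h | h
      · simpa using h
      · exfalso
        simp only [minkowski, h] at h1
        nlinarith [sq_nonneg (q 1), sq_nonneg (q 2), sq_nonneg (q 3)]
    have hqq : minkowski (-q) (-q) < 0 := by
      have : minkowski (-q) (-q) = minkowski q q := by simp [minkowski]
      rw [this, h1]; norm_num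
    have h3 := neg_minkowski_pos hqq hq0 (by rw [p.2.1]; norm_num) p.2.2
    have h4 : minkowski (-q) p.1 = - minkowski q p.1 := by simp [minkowski]; ring
    rw [h4, h2] at h3
    linarith [Real.cosh_pos t]⟩

lemma Hyp.geo_zero (p : H3) (e : Fin 4 → ℝ) (he : minkowski e e = 1) (hpe : minkowski p.1 e = 0) :
    Hyp.geo p e he hpe 0 = p := by
  apply Subtype.ext; simp [Hyp.geo]

lemma Hyp.dist_geo (p : H3) (e : Fin 4 → ℝ) (he : minkowski e e = 1)
    (hpe : minkowski p.1 e = 0) (s t : ℝ) :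
    dist (Hyp.geo p e he hpe s) (Hyp.geo p e he hpe t) = |s - t| := by
  apply Hyp.dist_eq_of_cosh (abs_nonneg _)
  rw [Real.cosh_abs, Real.cosh_sub]
  simp only [Hyp.geo, minkowski_add_left, minkowski_smul_left, minkowski_add_right,
    minkowski_smul_right, p.2.1, he, hpe, minkowski_comm e p.1]
  ring

/-- Two distinct points are joined by a geodesic, given with its two natural parametrizations. -/
lemma Hyp.exists_geo {p q : H3} (hpq : p ≠ q) :
    ∃ (e : Fin 4 → ℝ) (he : minkowski e e = 1) (hpe : minkowski p.1 e = 0),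
      Hyp.geo p e he hpe (dist p q) = q ∧
      ∀ t, (Hyp.geo p e he hpe t).1 = (Real.sinh (dist p q))⁻¹ •
        (Real.sinh (dist p q - t) • p.1 + Real.sinh t • q.1) := by
  have hd : 0 < dist p q := dist_pos.2 hpq
  have hs : 0 < Real.sinh (dist p q) := Real.sinh_pos_iff.2 hd
  have hc : minkowski p.1 q.1 = -Real.cosh (dist p q) := by
    rw [Hyp.dist_def, H3.cosh_dist]; ring
  set d := dist p q
  have he : minkowski ((Real.sinh d)⁻¹ • (q.1 + (-Real.cosh d) • p.1))
      ((Real.sinh d)⁻¹ • (q.1 + (-Real.cosh d) • p.1)) = 1 := by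
    simp only [minkowski_add_left, minkowski_smul_left, minkowski_add_right,
      minkowski_smul_right, p.2.1, q.2.1, minkowski_comm q.1 p.1, hc]
    field_simp
    nlinarith [Real.cosh_sq d]
  have hpe : minkowski p.1 ((Real.sinh d)⁻¹ • (q.1 + (-Real.cosh d) • p.1)) = 0 := by
    simp only [minkowski_add_right, minkowski_smul_right, p.2.1, hc]
    ring
  refine ⟨_, he, hpe, ?_, ?_⟩
  · apply Subtype.ext
    funext i
    simp only [Hyp.geo, Pi.add_apply, Pi.smul_apply, smul_eq_mul]
    field_simp
    ring
  · intro t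
    funext i
    simp only [Hyp.geo, Pi.add_apply, Pi.smul_apply, smul_eq_mul, Real.sinh_sub]
    field_simp
    ring

/-- The difference of the two sides is null and orthogonal to the timelike vector `b`, hence zero.
Pairing the identity with a fixed point gives the convexity of `cosh d` along geodesics. -/
lemma Hyp.midpoint_identity {a b c : H3} {h : ℝ} (hab : dist a b = h) (hbc : dist b c = h)
    (hac : dist a c = 2 * h) : a.1 + c.1 = (2 * Real.cosh h) • b.1 := by
  have k1 : minkowski a.1 b.1 = -Real.cosh h := by rw [← hab, Hyp.dist_def, H3.cosh_dist]; ring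
  have k2 : minkowski b.1 c.1 = -Real.cosh h := by rw [← hbc, Hyp.dist_def, H3.cosh_dist]; ring
  have k3 : minkowski a.1 c.1 = -Real.cosh (2 * h) := by
    rw [← hac, Hyp.dist_def, H3.cosh_dist]; ring
  have h1 : minkowski (a.1 + c.1 + (-(2 * Real.cosh h)) • b.1) b.1 = 0 := by
    simp only [minkowski_add_left, minkowski_smul_left, b.2.1, k1, minkowski_comm c.1 b.1, k2]
    ring
  have h2 : minkowski (a.1 + c.1 + (-(2 * Real.cosh h)) • b.1)
      (a.1 + c.1 + (-(2 * Real.cosh h)) • b.1) = 0 := by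
    simp only [minkowski_add_left, minkowski_smul_left, minkowski_add_right,
      minkowski_smul_right, a.2.1, b.2.1, c.2.1, k1, minkowski_comm c.1 b.1, k2,
      minkowski_comm b.1 a.1, minkowski_comm c.1 a.1, k3, Real.cosh_two_mul, Real.sinh_sq]
    ring
  have h3 := eq_zero_of_orthogonal_of_null b.2.1 h1 h2
  rw [neg_smul, ← sub_eq_add_neg, sub_eq_zero] at h3
  exact h3

/-- Any two points of `ℍ³` are exchanged by an isometric involution. -/
lemma Hyp.exists_isometry (x y : H3) :
    ∃ S : H3 → H3, S x = y ∧ (∀ p, S (S p) = p) ∧ ∀ p q, dist (S p) (S q) = dist p q := by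
  set C := minkowski x.1 y.1 with hC
  have hC1 : C ≤ -1 := by have := H3.one_le x y; linarith
  set m : Fin 4 → ℝ := x.1 + y.1 with hm
  have hmm : minkowski m m = 2 * C - 2 := by
    simp only [hm, minkowski_add_left, minkowski_add_right, x.2.1, y.2.1, minkowski_comm y.1 x.1]
    rw [← hC]; ring
  have hne : 2 * C - 2 ≠ 0 := by linarith
  clear_value m
  -- The geodesic symmetry about the midpoint of `x` and `y`, which is the direction of `m = x + y`.
  let T : (Fin 4 → ℝ) → (Fin 4 → ℝ) := fun z => (2 * minkowski z m / (2 * C - 2)) • m + (-1 : ℝ) • z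
  have hTm : ∀ z, minkowski (T z) m = minkowski z m := by
    intro z
    simp only [T, minkowski_add_left, minkowski_smul_left, hmm]
    rw [div_mul_cancel₀ _ hne]; ring
  have hT : ∀ z w, minkowski (T z) (T w) = minkowski z w := by
    intro z w
    simp only [T, minkowski_add_left, minkowski_smul_left, minkowski_add_right,
      minkowski_smul_right, hmm, minkowski_comm m w]
    have h1 : 2 * minkowski z m / (2 * C - 2) * (2 * C - 2) = 2 * minkowski z m :=
      div_mul_cancel₀ _ hne
    have h2 : 2 * minkowski w m / (2 * C - 2) * (2 * C - 2) = 2 * minkowski w m :=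
      div_mul_cancel₀ _ hne
    linear_combination (2 * minkowski w m / (2 * C - 2)) * h1
  have hTT : ∀ z, T (T z) = z := by
    intro z
    have : T (T z) = (2 * minkowski (T z) m / (2 * C - 2)) • m + (-1 : ℝ) • T z := rfl
    rw [this, hTm]
    simp only [T, smul_add, smul_smul]
    funext i
    simp only [Pi.add_apply, Pi.smul_apply, smul_eq_mul]
    ring
  have hm0 : 0 < m 0 := by rw [hm]; exact add_pos x.2.2 y.2.2
  have hpos : ∀ z : H3, 0 < T z.1 0 := by
    intro z
    have hz1 : minkowski (T z.1) (T z.1) = -1 := by rw [hT, z.2.1]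
    have hz2 : minkowski (T z.1) m < 0 := by
      rw [hTm]
      have := neg_minkowski_pos (x := z.1) (y := m) (by rw [z.2.1]; norm_num) z.2.2
        (by rw [hmm]; linarith) hm0
      linarith
    generalize T z.1 = q at *
    by_contra hneg
    push Not at hneg
    have hq0 : 0 < (-q) 0 := by
      rcases hneg.lt_or_eq with h | h
      · simpa using h
      · exfalso
        simp only [minkowski, h] at hz1
        nlinarith [sq_nonneg (q 1), sq_nonneg (q 2), sq_nonneg (q 3)]
    have hqq : minkowski (-q) (-q) < 0 := by
      have : minkowski (-q) (-q) = minkowski q q := by simp [minkowski]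
      rw [this, hz1]; norm_num
    have h3 := neg_minkowski_pos hqq hq0 (by rw [hmm]; linarith) hm0
    have h4 : minkowski (-q) m = - minkowski q m := by simp [minkowski]; ring
    rw [h4] at h3
    linarith
  refine ⟨fun z => ⟨T z.1, by rw [hT, z.2.1], hpos z⟩, ?_, ?_, ?_⟩
  · apply Subtype.ext
    have hxm : minkowski x.1 m = C - 1 := by
      rw [hm, minkowski_add_right, x.2.1, ← hC]; ring
    have h1 : 2 * (C - 1) / (2 * C - 2) = 1 := by
      rw [div_eq_one_iff_eq hne]; ring
    change (2 * minkowski x.1 m / (2 * C - 2)) • m + (-1 : ℝ) • x.1 = y.1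
    rw [hxm, h1, hm, one_smul, neg_one_smul]
    abel
  · intro p
    exact Subtype.ext (hTT p.1)
  · intro p q
    exact Hyp.dist_eq_of_minkowski (hT p.1 q.1)

/-- Through any point `b` and any other point `a` there is a point opposite to `a`. -/
lemma Hyp.exists_antipode {a b : H3} (h : b ≠ a) :
    ∃ c, dist b c = dist b a ∧ dist a c = 2 * dist b a := by
  obtain ⟨e, he, hpe, h1, -⟩ := Hyp.exists_geo h
  refine ⟨Hyp.geo b e he hpe (-dist b a), ?_, ?_⟩
  · have := Hyp.dist_geo b e he hpe 0 (-dist b a)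
    rwa [Hyp.geo_zero, sub_neg_eq_add, zero_add, abs_of_nonneg dist_nonneg] at this
  · have := Hyp.dist_geo b e he hpe (dist b a) (-dist b a)
    rwa [h1, sub_neg_eq_add, ← two_mul, abs_of_nonneg (by positivity)] at this

/-- There is no locally geodesic loop in `ℍ³`. -/
lemma Hyp.no_geodesic_loop {γ : ℝ → H3} {d : ℝ} (hd : 0 < d)
    (hγ : ∀ t ∈ Set.Icc 0 d, ∃ ε > 0, ∀ s ∈ Set.Icc 0 d, ∀ s' ∈ Set.Icc 0 d,
      |s - t| < ε → |s' - t| < ε → dist (γ s) (γ s') = |s - s'|) : γ 0 ≠ γ d := by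
  intro hloop
  set u : ℝ → ℝ := fun t => dist (γ 0) (γ t) with hu
  have hu0 : ∀ t, 0 ≤ u t := fun t => dist_nonneg
  have hcont : ContinuousOn u (Set.Icc 0 d) := by
    rw [Metric.continuousOn_iff]
    intro t ht η hη
    obtain ⟨ε, hε, h⟩ := hγ t ht
    refine ⟨min ε η, lt_min hε hη, fun s hs hst => ?_⟩
    rw [Real.dist_eq] at hst ⊢
    have h1 := h s hs t ht (hst.trans_le (min_le_left _ _)) (by simpa using hε)
    calc |u s - u t| ≤ dist (γ s) (γ t) := by
          simp only [hu, dist_comm (γ 0)]; exact abs_dist_sub_le _ _ _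
      _ = |s - t| := h1
      _ < η := hst.trans_le (min_le_right _ _)
  -- By the midpoint identity, `cosh u(t-η) + cosh u(t+η) = 2 cosh η cosh u(t) > 2 cosh u(t)`, so
  -- `u` has no interior maximum.
  have hnomax : ∀ t ∈ Set.Ioo 0 d, ¬ IsMaxOn u (Set.Icc 0 d) t := by
    intro t ht hmax
    obtain ⟨ε, hε, h⟩ := hγ t ⟨ht.1.le, ht.2.le⟩
    obtain ⟨η, hη0, hη⟩ := exists_between (lt_min hε (lt_min ht.1 (sub_pos.2 ht.2)))
    have e1 := lt_min_iff.1 hη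
    have e2 := lt_min_iff.1 e1.2
    have m1 : t - η ∈ Set.Icc 0 d := ⟨by linarith, by linarith [ht.2]⟩
    have m2 : t + η ∈ Set.Icc 0 d := ⟨by linarith [ht.1], by linarith⟩
    have m0 : t ∈ Set.Icc 0 d := ⟨ht.1.le, ht.2.le⟩
    have a1 : |t - η - t| < ε := by
      rw [sub_sub_cancel_left, abs_neg, abs_of_pos hη0]; exact e1.1
    have a2 : |t + η - t| < ε := by rw [add_sub_cancel_left, abs_of_pos hη0]; exact e1.1
    have a0 : |t - t| < ε := by simpa using hε
    have d1 := h _ m1 _ m0 a1 a0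
    have d2 := h _ m0 _ m2 a0 a2
    have d3 := h _ m1 _ m2 a1 a2
    rw [sub_sub_cancel_left, abs_neg, abs_of_pos hη0] at d1
    rw [show t - (t + η) = -η by ring, abs_neg, abs_of_pos hη0] at d2
    rw [show t - η - (t + η) = -(2 * η) by ring, abs_neg, abs_of_pos (by positivity)] at d3
    have key := Hyp.midpoint_identity d1 d2 d3
    have key2 : Real.cosh (u (t - η)) + Real.cosh (u (t + η)) =
        2 * Real.cosh η * Real.cosh (u t) := by
      simp only [hu, Hyp.dist_def, H3.cosh_dist]
      have := congrArg (minkowski (γ 0).1) key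
      rw [minkowski_add_right, minkowski_smul_right] at this
      linarith
    have c1 : Real.cosh (u (t - η)) ≤ Real.cosh (u t) :=
      Real.cosh_le_cosh.2 (by
        rw [abs_of_nonneg (hu0 _), abs_of_nonneg (hu0 _)]; exact hmax m1)
    have c2 : Real.cosh (u (t + η)) ≤ Real.cosh (u t) :=
      Real.cosh_le_cosh.2 (by
        rw [abs_of_nonneg (hu0 _), abs_of_nonneg (hu0 _)]; exact hmax m2)
    have c3 := Real.one_lt_cosh.2 hη0.ne'
    nlinarith [Real.cosh_pos (u t)]
  obtain ⟨t, ht, hmax⟩ := isCompact_Icc.exists_isMaxOn (Set.nonempty_Icc.2 hd.le) hcont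
  have hends : u 0 = 0 ∧ u d = 0 := by
    constructor
    · simp [hu]
    · simp [hu, hloop]
  by_cases hint : t ∈ Set.Ioo 0 d
  · exact hnomax t hint hmax
  · have ht0 : u t = 0 := by
      rcases eq_or_lt_of_le ht.1 with h | h
      · rw [← h]; exact hends.1
      · rcases eq_or_lt_of_le ht.2 with h' | h'
        · rw [h']; exact hends.2
        · exact absurd ⟨h, h'⟩ hint
    -- A maximum at an end point has value `0`, so `u` vanishes identically and every interior point
    -- is a maximum too.
    refine hnomax (d / 2) ⟨by positivity, by linarith⟩ fun s hs => ?_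
    have h1 : u s ≤ u t := hmax hs
    exact h1.trans (ht0.le.trans (hu0 _))

/-! ### Cylindrical coordinates and lengths of curves -/

/-- The point of `ℍ³` with cylindrical coordinates `(r, ζ, θ)`. -/
def Hyp.pt (r z t : ℝ) : H3 :=
  ⟨![Real.cosh r * Real.cosh z, Real.cosh r * Real.sinh z, Real.sinh r * Real.cos t,
      Real.sinh r * Real.sin t], by
    refine ⟨?_, by simpa using mul_pos (Real.cosh_pos r) (Real.cosh_pos z)⟩
    simp only [minkowski, Matrix.cons_val]
    linear_combination (-(Real.cosh r ^ 2)) * Real.cosh_sq z - Real.cosh_sq r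
      + Real.sinh r ^ 2 * Real.sin_sq_add_cos_sq t⟩

lemma Hyp.minkowski_pt (r z t r' z' t' : ℝ) :
    -minkowski (Hyp.pt r z t).1 (Hyp.pt r' z' t').1 =
      Real.cosh r * Real.cosh r' * Real.cosh (z - z')
        - Real.sinh r * Real.sinh r' * Real.cos (t - t') := by
  simp only [minkowski, Hyp.pt, Matrix.cons_val, Real.cosh_sub, Real.cos_sub]
  ring

lemma Hyp.cosh_dist_pt (r z t r' z' t' : ℝ) :
    Real.cosh (dist (Hyp.pt r z t) (Hyp.pt r' z' t')) =
      Real.cosh r * Real.cosh r' * Real.cosh (z - z')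
        - Real.sinh r * Real.sinh r' * Real.cos (t - t') := by
  rw [Hyp.dist_def, H3.cosh_dist, Hyp.minkowski_pt]

/-- The speed of a curve in cylindrical coordinates. -/
def cylSpeed (r z θ : ℝ → ℝ) (t : ℝ) : ℝ :=
  Real.sqrt ((deriv r t) ^ 2 + (Real.cosh (r t)) ^ 2 * (deriv z t) ^ 2
      + (Real.sinh (r t)) ^ 2 * (deriv θ t) ^ 2)

lemma cylSpeed_nonneg (r z θ : ℝ → ℝ) (t : ℝ) : 0 ≤ cylSpeed r z θ t := Real.sqrt_nonneg _

lemma continuous_cylSpeed {r z θ : ℝ → ℝ} (hr : ContDiff ℝ 1 r) (hz : ContDiff ℝ 1 z)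
    (hθ : ContDiff ℝ 1 θ) : Continuous (cylSpeed r z θ) := by
  have h1 := hr.continuous_deriv le_rfl
  have h2 := hz.continuous_deriv le_rfl
  have h3 := hθ.continuous_deriv le_rfl
  have h4 := hr.continuous
  unfold cylSpeed
  exact Real.continuous_sqrt.comp (((h1.pow 2).add (((Real.continuous_cosh.comp h4).pow 2).mul
    (h2.pow 2))).add (((Real.continuous_sinh.comp h4).pow 2).mul (h3.pow 2)))

lemma CylCurve.length_eq (c : CylCurve) :
    c.length = ∫ t in (0 : ℝ)..1, cylSpeed c.r c.zeta c.theta t := rfl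

/-- The velocity in `ℝ⁴` of a curve given in cylindrical coordinates. -/
def Hyp.vel (r z t r' z' t' : ℝ) : Fin 4 → ℝ :=
  ![Real.sinh r * r' * Real.cosh z + Real.cosh r * (Real.sinh z * z'),
    Real.sinh r * r' * Real.sinh z + Real.cosh r * (Real.cosh z * z'),
    Real.cosh r * r' * Real.cos t + Real.sinh r * (-Real.sin t * t'),
    Real.cosh r * r' * Real.sin t + Real.sinh r * (Real.cos t * t')]

lemma Hyp.vel_self (r z t r' z' t' : ℝ) :
    minkowski (Hyp.vel r z t r' z' t') (Hyp.vel r z t r' z' t') =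
      r' ^ 2 + Real.cosh r ^ 2 * z' ^ 2 + Real.sinh r ^ 2 * t' ^ 2 := by
  simp only [minkowski, Hyp.vel, Matrix.cons_val]
  linear_combination (-(Real.sinh r ^ 2 * r' ^ 2) + Real.cosh r ^ 2 * z' ^ 2) * Real.cosh_sq z
    + (r' ^ 2) * Real.cosh_sq r
    + (Real.sinh r ^ 2 * t' ^ 2 + Real.cosh r ^ 2 * r' ^ 2) * Real.sin_sq_add_cos_sq t

lemma Hyp.vel_orthogonal (r z t r' z' t' : ℝ) :
    minkowski (Hyp.vel r z t r' z' t') (Hyp.pt r z t).1 = 0 := by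
  simp only [minkowski, Hyp.vel, Hyp.pt, Matrix.cons_val]
  linear_combination (-(Real.sinh r * Real.cosh r * r')) * Real.cosh_sq z
    + (Real.sinh r * Real.cosh r * r') * Real.sin_sq_add_cos_sq t

lemma Hyp.hasDerivAt_pt {r z θ : ℝ → ℝ} {r' z' θ' t : ℝ} (hr : HasDerivAt r r' t)
    (hz : HasDerivAt z z' t) (hθ : HasDerivAt θ θ' t) :
    HasDerivAt (fun s => (Hyp.pt (r s) (z s) (θ s)).1)
      (Hyp.vel (r t) (z t) (θ t) r' z' θ') t := by
  rw [hasDerivAt_pi]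
  intro i
  fin_cases i
  · exact hr.cosh.mul hz.cosh
  · exact hr.cosh.mul hz.sinh
  · exact hr.sinh.mul hθ.cos
  · exact hr.sinh.mul hθ.sin

lemma hasDerivAt_minkowski {x : ℝ → Fin 4 → ℝ} {v : Fin 4 → ℝ} {t : ℝ} (p : Fin 4 → ℝ)
    (hx : HasDerivAt x v t) : HasDerivAt (fun s => minkowski p (x s)) (minkowski p v) t := by
  rw [hasDerivAt_pi] at hx
  exact ((((hx 0).const_mul _).neg.add ((hx 1).const_mul _)).add ((hx 2).const_mul _)).add
    ((hx 3).const_mul _)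

/-- The length of a curve in `ℍ³` is at least the distance of its end points. -/
lemma Hyp.dist_le_length {r z θ : ℝ → ℝ} (hr : ContDiff ℝ 1 r) (hz : ContDiff ℝ 1 z)
    (hθ : ContDiff ℝ 1 θ) {a b : ℝ} (hab : a ≤ b) :
    dist (Hyp.pt (r a) (z a) (θ a)) (Hyp.pt (r b) (z b) (θ b)) ≤
      ∫ t in a..b, cylSpeed r z θ t := by
  set c : ℝ → H3 := fun t => Hyp.pt (r t) (z t) (θ t) with hc
  set v : ℝ → Fin 4 → ℝ :=
    fun t => Hyp.vel (r t) (z t) (θ t) (deriv r t) (deriv z t) (deriv θ t) with hv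
  set u : ℝ → ℝ := fun t => -minkowski (c a).1 (c t).1 with hu
  have hu1 : ∀ t, 1 ≤ u t := fun t => H3.one_le _ _
  have hud : ∀ t, HasDerivAt u (-minkowski (c a).1 (v t)) t := fun t =>
    (hasDerivAt_minkowski _ (Hyp.hasDerivAt_pt
      ((hr.differentiable one_ne_zero) t).hasDerivAt
      ((hz.differentiable one_ne_zero) t).hasDerivAt
      ((hθ.differentiable one_ne_zero) t).hasDerivAt)).neg
  -- Cauchy–Schwarz in the tangent space at `c t`: the component of `c a` there has squared norm `u²
  -- - 1`.
  have hspeed : ∀ t, (minkowski (c a).1 (v t)) ^ 2 ≤ cylSpeed r z θ t ^ 2 * (u t ^ 2 - 1) := by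
    intro t
    have h1 : minkowski ((c a).1 + minkowski (c a).1 (c t).1 • (c t).1) (c t).1 = 0 := by
      rw [minkowski_add_left, minkowski_smul_left, (c t).2.1]; ring
    have h2 : minkowski (v t) (c t).1 = 0 := Hyp.vel_orthogonal _ _ _ _ _ _
    have h3 := minkowski_cauchy_schwarz (c t).2.1 h1 h2
    have h4 : minkowski (v t) (v t) = cylSpeed r z θ t ^ 2 := by
      rw [hv, Hyp.vel_self, cylSpeed, Real.sq_sqrt (by positivity)]
    rw [h4] at h3
    simp only [minkowski_add_left, minkowski_smul_left, minkowski_add_right,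
      minkowski_smul_right, (c a).2.1, (c t).2.1, minkowski_comm (c t).1 (c a).1,
      minkowski_comm (c t).1 (v t), h2] at h3
    simp only [hu]
    linarith
  -- `arcosh` is not differentiable at `1 = u a`, so its argument is shifted by `k > 0`, and `k → 0`
  -- at the end.
  have hk : ∀ k : ℝ, 0 < k →
      Real.arcosh (u b + k) ≤ Real.arcosh (1 + k) + ∫ t in a..b, cylSpeed r z θ t := by
    intro k hk
    have hg : ∀ t, HasDerivAt (fun s => Real.arcosh (u s + k))
        ((√((u t + k) ^ 2 - 1))⁻¹ * (-minkowski (c a).1 (v t))) t := by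
      intro t
      have h1 : u t + k ∈ Set.Ioi 1 := by
        have := hu1 t
        simp only [Set.mem_Ioi]; linarith
      exact HasDerivAt.comp (h₂ := Real.arcosh) t (Real.hasDerivAt_arcosh h1)
        ((hud t).add_const k)
    have := intervalIntegral.sub_le_integral_of_hasDeriv_right_of_le hab
      (fun t _ => (hg t).continuousAt.continuousWithinAt)
      (fun t _ => (hg t).hasDerivWithinAt)
      ((continuous_cylSpeed hr hz hθ).integrableOn_Icc) (fun t _ => by
        have h1 := hu1 t
        have h2 : 0 < (u t + k) ^ 2 - 1 := by nlinarith
        have h3 := Real.sqrt_pos.2 h2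
        rw [inv_mul_le_iff₀ h3]
        apply le_of_sq_le_sq
        · rw [neg_sq, mul_pow, Real.sq_sqrt h2.le]
          refine (hspeed t).trans ?_
          rw [mul_comm]
          apply mul_le_mul_of_nonneg_right _ (sq_nonneg _)
          nlinarith
        · exact mul_nonneg h3.le (cylSpeed_nonneg _ _ _ _))
    have hua : u a = 1 := by simp only [hu, (c a).2.1]; norm_num
    rw [hua] at this
    linarith
  have ht : ∀ x : ℝ, 1 ≤ x → Filter.Tendsto (fun k : ℝ => Real.arcosh (x + k))
      (nhdsWithin 0 (Set.Ioi 0)) (nhds (Real.arcosh x)) := by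
    intro x hx
    have h1 : Filter.Tendsto (fun k : ℝ => x + k) (nhdsWithin 0 (Set.Ioi 0))
        (nhdsWithin x (Set.Ici 1)) := by
      apply tendsto_nhdsWithin_of_tendsto_nhds_of_eventually_within
      · have : Filter.Tendsto (fun k : ℝ => x + k) (nhds 0) (nhds (x + 0)) :=
          (continuous_const.add continuous_id).tendsto 0
        rw [add_zero] at this
        exact this.mono_left nhdsWithin_le_nhds
      · filter_upwards [self_mem_nhdsWithin] with k hk
        simp only [Set.mem_Ioi, Set.mem_Ici] at *
        linarith
    exact (Real.continuousOn_arcosh x hx).tendsto.comp h1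
  have hlim := le_of_tendsto_of_tendsto (ht (u b) (hu1 b))
    ((ht 1 le_rfl).add_const (∫ t in a..b, cylSpeed r z θ t))
    (by filter_upwards [self_mem_nhdsWithin] with k hk0 using hk k hk0)
  rw [Real.arcosh_zero, zero_add] at hlim
  exact hlim

/-! ### Concatenation of curves and the triangle inequality in `Ĥ³` -/

lemma cylSpeed_eq_of_hasDerivAt {r z θ : ℝ → ℝ} {r' z' θ' t : ℝ} (hr : HasDerivAt r r' t)
    (hz : HasDerivAt z z' t) (hθ : HasDerivAt θ θ' t) :
    cylSpeed r z θ t = Real.sqrt (r' ^ 2 + (Real.cosh (r t)) ^ 2 * z' ^ 2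
      + (Real.sinh (r t)) ^ 2 * θ' ^ 2) := by
  rw [cylSpeed, hr.deriv, hz.deriv, hθ.deriv]

lemma hasDerivAt_smoothTransition (x : ℝ) :
    HasDerivAt Real.smoothTransition (deriv Real.smoothTransition x) x :=
  ((Real.smoothTransition.contDiff (n := 1)).differentiable one_ne_zero x).hasDerivAt

lemma continuous_deriv_smoothTransition : Continuous (deriv Real.smoothTransition) :=
  (Real.smoothTransition.contDiff (n := 1)).continuous_deriv le_rfl

lemma deriv_smoothTransition_nonneg (x : ℝ) : 0 ≤ deriv Real.smoothTransition x :=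
  Real.smoothTransition.monotone.deriv_nonneg

/-- The value `0` is the global minimum, so the derivative vanishes even at the corner `x = 0`. -/
lemma deriv_smoothTransition_of_nonpos {x : ℝ} (hx : x ≤ 0) :
    deriv Real.smoothTransition x = 0 := by
  apply IsLocalMin.deriv_eq_zero
  refine Filter.Eventually.of_forall fun y => ?_
  rw [Real.smoothTransition.zero_of_nonpos hx]
  exact Real.smoothTransition.nonneg y

lemma deriv_smoothTransition_of_one_le {x : ℝ} (hx : 1 ≤ x) :
    deriv Real.smoothTransition x = 0 := by
  apply IsLocalMax.deriv_eq_zero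
  refine Filter.Eventually.of_forall fun y => ?_
  rw [Real.smoothTransition.one_of_one_le hx]
  exact Real.smoothTransition.le_one y

/-- Smooth reparametrization of `[k/3, (k+1)/3]` by `[0,1]`. -/
def stepFn (k t : ℝ) : ℝ := Real.smoothTransition (3 * t - k)

lemma contDiff_stepFn (k : ℝ) : ContDiff ℝ 1 (stepFn k) :=
  Real.smoothTransition.contDiff.comp ((contDiff_const.mul contDiff_id).sub contDiff_const)

/-- The derivative of `stepFn`. -/
def stepFn' (k t : ℝ) : ℝ := 3 * deriv Real.smoothTransition (3 * t - k)

lemma hasDerivAt_stepFn (k t : ℝ) : HasDerivAt (stepFn k) (stepFn' k t) t := by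
  have h1 : HasDerivAt (fun t : ℝ => 3 * t - k) 3 t := by
    simpa using ((hasDerivAt_id t).const_mul 3).sub_const k
  have := HasDerivAt.comp t (hasDerivAt_smoothTransition (3 * t - k)) h1
  rw [mul_comm] at this
  exact this

lemma stepFn'_nonneg (k t : ℝ) : 0 ≤ stepFn' k t :=
  mul_nonneg (by norm_num) (deriv_smoothTransition_nonneg _)

lemma continuous_stepFn' (k : ℝ) : Continuous (stepFn' k) :=
  continuous_const.mul (continuous_deriv_smoothTransition.comp (by fun_prop))

lemma stepFn_of_le {k t : ℝ} (h : 3 * t ≤ k) : stepFn k t = 0 ∧ stepFn' k t = 0 :=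
  ⟨Real.smoothTransition.zero_of_nonpos (by linarith), by
    rw [stepFn', deriv_smoothTransition_of_nonpos (by linarith), mul_zero]⟩

lemma stepFn_of_ge {k t : ℝ} (h : k + 1 ≤ 3 * t) : stepFn k t = 1 ∧ stepFn' k t = 0 :=
  ⟨Real.smoothTransition.one_of_one_le (by linarith), by
    rw [stepFn', deriv_smoothTransition_of_one_le (by linarith), mul_zero]⟩

lemma stepFn_mem (k t : ℝ) : stepFn k t ∈ Set.Icc (0 : ℝ) 1 :=
  ⟨Real.smoothTransition.nonneg _, Real.smoothTransition.le_one _⟩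

lemma CylCurve.length_nonneg (c : CylCurve) : 0 ≤ c.length := by
  rw [CylCurve.length_eq]
  exact intervalIntegral.integral_nonneg zero_le_one fun t _ => cylSpeed_nonneg _ _ _ t

lemma HatH3.bddBelow_lengths (x y : HatH3) :
    BddBelow {L : ℝ | ∃ c : CylCurve, c.source = x ∧ c.target = y ∧ L = c.length} := by
  refine ⟨0, ?_⟩
  rintro L ⟨c, -, -, rfl⟩
  exact c.length_nonneg

lemma HatH3.dist_le_length (c : CylCurve) : HatH3.dist c.source c.target ≤ c.length :=
  csInf_le (HatH3.bddBelow_lengths _ _) ⟨c, rfl, rfl, rfl⟩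

lemma HatH3.mk_eq_mk {p q : Cyl} :
    HatH3.mk p = HatH3.mk q ↔ p.r = q.r ∧ p.zeta = q.zeta ∧ (p.r = 0 ∨ p.theta = q.theta) :=
  Quotient.eq (r := cylSetoid)

lemma HatH3.exists_mk (x : HatH3) : ∃ p : Cyl, HatH3.mk p = x := Quotient.exists_rep x

lemma HatH3.dist_nonneg (x y : HatH3) : 0 ≤ HatH3.dist x y := by
  apply Real.sInf_nonneg
  rintro L ⟨c, -, -, rfl⟩
  exact c.length_nonneg

/-- The curve which is affine in cylindrical coordinates. -/
def CylCurve.affine (p q : Cyl) : CylCurve where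
  r t := p.r + t * (q.r - p.r)
  zeta t := p.zeta + t * (q.zeta - p.zeta)
  theta t := p.theta + t * (q.theta - p.theta)
  r_smooth := by fun_prop
  zeta_smooth := by fun_prop
  theta_smooth := by fun_prop
  r_nonneg t ht := by nlinarith [p.r_nonneg, q.r_nonneg, ht.1, ht.2]

lemma CylCurve.affine_source (p q : Cyl) : (CylCurve.affine p q).source = HatH3.mk p := by
  simp [CylCurve.source, CylCurve.affine]

lemma CylCurve.affine_target (p q : Cyl) : (CylCurve.affine p q).target = HatH3.mk q := by
  simp [CylCurve.target, CylCurve.affine]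

lemma HatH3.lengths_nonempty (x y : HatH3) :
    {L : ℝ | ∃ c : CylCurve, c.source = x ∧ c.target = y ∧ L = c.length}.Nonempty := by
  obtain ⟨p, rfl⟩ := x.exists_mk
  obtain ⟨q, rfl⟩ := y.exists_mk
  exact ⟨_, CylCurve.affine p q, CylCurve.affine_source p q, CylCurve.affine_target p q, rfl⟩

lemma hasDerivAt_affine (a b t : ℝ) : HasDerivAt (fun t : ℝ => a + t * b) b t := by
  simpa using ((hasDerivAt_id t).mul_const b).const_add a

lemma HatH3.dist_radial_le (r r' z t : ℝ) (hr : 0 ≤ r) (hr' : 0 ≤ r') :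
    HatH3.dist (HatH3.mk ⟨r, z, t, hr⟩) (HatH3.mk ⟨r', z, t, hr'⟩) ≤ |r' - r| := by
  have h := HatH3.dist_le_length (CylCurve.affine ⟨r, z, t, hr⟩ ⟨r', z, t, hr'⟩)
  rw [CylCurve.affine_source, CylCurve.affine_target] at h
  refine h.trans (le_of_eq ?_)
  rw [CylCurve.length_eq]
  have : ∀ s, cylSpeed (CylCurve.affine ⟨r, z, t, hr⟩ ⟨r', z, t, hr'⟩).r
      (CylCurve.affine ⟨r, z, t, hr⟩ ⟨r', z, t, hr'⟩).zeta
      (CylCurve.affine ⟨r, z, t, hr⟩ ⟨r', z, t, hr'⟩).theta s = |r' - r| := by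
    intro s
    refine (cylSpeed_eq_of_hasDerivAt (hasDerivAt_affine _ _ s) (hasDerivAt_affine _ _ s)
      (hasDerivAt_affine _ _ s)).trans ?_
    simp [Real.sqrt_sq_eq_abs]
  simp [this]

lemma sqrt_speed_mul (a b r z t s : ℝ) (hs : 0 ≤ s) :
    Real.sqrt ((r * s) ^ 2 + a * (z * s) ^ 2 + b * (t * s) ^ 2) =
      Real.sqrt (r ^ 2 + a * z ^ 2 + b * t ^ 2) * s := by
  rw [show (r * s) ^ 2 + a * (z * s) ^ 2 + b * (t * s) ^ 2 =
    (r ^ 2 + a * z ^ 2 + b * t ^ 2) * s ^ 2 by ring, Real.sqrt_mul' _ (sq_nonneg s),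
    Real.sqrt_sq hs]

lemma integral_reparam {f : ℝ → ℝ} (hf : Continuous f) (k a b : ℝ) (ha : 3 * a = k)
    (hb : 3 * b = k + 1) :
    ∫ t in a..b, f (stepFn k t) * stepFn' k t = ∫ t in (0 : ℝ)..1, f t := by
  have := intervalIntegral.integral_comp_mul_deriv (a := a) (b := b) (f := stepFn k)
    (f' := stepFn' k) (g := f) (fun t _ => hasDerivAt_stepFn k t)
    (continuous_stepFn' k).continuousOn hf
  rw [(stepFn_of_le ha.le).1, (stepFn_of_ge hb.ge).1] at this
  exact this

/-- Run `c` on the first third and `d` on the last; the steps are flat at their ends, so the result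
is `C¹`. If the curves meet on the core, their angles there may differ. The middle third turns one
angle into the other at no cost. -/
lemma CylCurve.exists_concat (c d : CylCurve) (h : c.target = d.source) :
    ∃ e : CylCurve, e.source = c.source ∧ e.target = d.target ∧
      e.length = c.length + d.length := by
  obtain ⟨hr, hz, hθ⟩ := HatH3.mk_eq_mk.1 h
  simp only at hr hz hθ
  have hrs : ∀ t, 3 * t ≤ 2 → c.r (stepFn 0 t) + d.r (stepFn 2 t) - d.r 0 = c.r (stepFn 0 t) := by
    intro t ht
    rw [(stepFn_of_le ht).1]; ring
  have hrs' : ∀ t, 1 ≤ 3 * t →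
      c.r (stepFn 0 t) + d.r (stepFn 2 t) - d.r 0 = d.r (stepFn 2 t) := by
    intro t ht
    rw [(stepFn_of_ge (by linarith : (0 : ℝ) + 1 ≤ 3 * t)).1, hr]; ring
  let e : CylCurve :=
    { r := fun t => c.r (stepFn 0 t) + d.r (stepFn 2 t) - d.r 0
      zeta := fun t => c.zeta (stepFn 0 t) + d.zeta (stepFn 2 t) - d.zeta 0
      theta := fun t => c.theta (stepFn 0 t) + d.theta (stepFn 2 t) +
        stepFn 1 t * (d.theta 0 - c.theta 1) - d.theta 0
      r_smooth := ((c.r_smooth.comp (contDiff_stepFn 0)).add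
        (d.r_smooth.comp (contDiff_stepFn 2))).sub contDiff_const
      zeta_smooth := ((c.zeta_smooth.comp (contDiff_stepFn 0)).add
        (d.zeta_smooth.comp (contDiff_stepFn 2))).sub contDiff_const
      theta_smooth := (((c.theta_smooth.comp (contDiff_stepFn 0)).add
        (d.theta_smooth.comp (contDiff_stepFn 2))).add
        ((contDiff_stepFn 1).mul contDiff_const)).sub contDiff_const
      r_nonneg := by
        intro t _
        rcases le_total (3 * t) 2 with ht | ht
        · rw [hrs t ht]; exact c.r_nonneg _ (stepFn_mem _ _)
        · rw [hrs' t (by linarith)]; exact d.r_nonneg _ (stepFn_mem _ _) }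
  have hd : ∀ {f : ℝ → ℝ} (_ : ContDiff ℝ 1 f) (k t : ℝ),
      HasDerivAt (fun t => f (stepFn k t)) (deriv f (stepFn k t) * stepFn' k t) t :=
    fun hf k t => HasDerivAt.comp t ((hf.differentiable one_ne_zero) _).hasDerivAt
      (hasDerivAt_stepFn k t)
  have hspeed : ∀ t, cylSpeed e.r e.zeta e.theta t = Real.sqrt
      ((deriv c.r (stepFn 0 t) * stepFn' 0 t + deriv d.r (stepFn 2 t) * stepFn' 2 t) ^ 2 +
      Real.cosh (e.r t) ^ 2 *
      (deriv c.zeta (stepFn 0 t) * stepFn' 0 t + deriv d.zeta (stepFn 2 t) * stepFn' 2 t) ^ 2 +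
      Real.sinh (e.r t) ^ 2 *
      (deriv c.theta (stepFn 0 t) * stepFn' 0 t + deriv d.theta (stepFn 2 t) * stepFn' 2 t +
        stepFn' 1 t * (d.theta 0 - c.theta 1)) ^ 2) := by
    intro t
    exact cylSpeed_eq_of_hasDerivAt
      (((hd c.r_smooth 0 t).add (hd d.r_smooth 2 t)).sub_const _)
      (((hd c.zeta_smooth 0 t).add (hd d.zeta_smooth 2 t)).sub_const _)
      ((((hd c.theta_smooth 0 t).add (hd d.theta_smooth 2 t)).add
        ((hasDerivAt_stepFn 1 t).mul_const _)).sub_const _)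
  have hint : ∀ a b : ℝ, IntervalIntegrable (cylSpeed e.r e.zeta e.theta) MeasureTheory.volume a b :=
    fun a b => (continuous_cylSpeed e.r_smooth e.zeta_smooth e.theta_smooth).intervalIntegrable a b
  refine ⟨e, ?_, ?_, ?_⟩
  · have h0 : stepFn 0 0 = 0 := (stepFn_of_le (by norm_num)).1
    have h1 : stepFn 1 0 = 0 := (stepFn_of_le (by norm_num)).1
    have h2 : stepFn 2 0 = 0 := (stepFn_of_le (by norm_num)).1
    exact HatH3.mk_eq_mk.2 ⟨by simp [e, h0, h2], by simp [e, h0, h2],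
      Or.inr (by simp [e, h0, h1, h2])⟩
  · have h0 : stepFn 0 1 = 1 := (stepFn_of_ge (by norm_num)).1
    have h1 : stepFn 1 1 = 1 := (stepFn_of_ge (by norm_num)).1
    have h2 : stepFn 2 1 = 1 := (stepFn_of_ge (by norm_num)).1
    exact HatH3.mk_eq_mk.2 ⟨by simp [e, h0, h2, hr], by simp [e, h0, h2, hz],
      Or.inr (by simp only [e, h0, h1, h2]; ring)⟩
  · rw [CylCurve.length_eq, CylCurve.length_eq, CylCurve.length_eq,
      ← intervalIntegral.integral_add_adjacent_intervals (hint 0 (1 / 3)) (hint (1 / 3) 1),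
      ← intervalIntegral.integral_add_adjacent_intervals (hint (1 / 3) (2 / 3)) (hint (2 / 3) 1)]
    have i1 : ∫ t in (0 : ℝ)..(1 / 3), cylSpeed e.r e.zeta e.theta t =
        ∫ t in (0 : ℝ)..1, cylSpeed c.r c.zeta c.theta t := by
      rw [← integral_reparam (continuous_cylSpeed c.r_smooth c.zeta_smooth c.theta_smooth) 0 0
        (1 / 3) (by norm_num) (by norm_num)]
      apply intervalIntegral.integral_congr
      intro t ht
      rw [Set.uIcc_of_le (by norm_num)] at ht
      have e1 := stepFn_of_le (k := 1) (t := t) (by linarith [ht.2])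
      have e2 := stepFn_of_le (k := 2) (t := t) (by linarith [ht.2])
      have e3 : e.r t = c.r (stepFn 0 t) := hrs t (by linarith [ht.2])
      simp only [hspeed, e1.2, e2.2, e3, mul_zero, add_zero, zero_mul]
      exact sqrt_speed_mul (Real.cosh (c.r (stepFn 0 t)) ^ 2)
        (Real.sinh (c.r (stepFn 0 t)) ^ 2) (deriv c.r (stepFn 0 t))
        (deriv c.zeta (stepFn 0 t)) (deriv c.theta (stepFn 0 t)) (stepFn' 0 t)
        (stepFn'_nonneg 0 t)
    have i2 : ∫ t in (1 / 3 : ℝ)..(2 / 3), cylSpeed e.r e.zeta e.theta t = 0 := by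
      rw [← intervalIntegral.integral_zero (a := (1 / 3 : ℝ)) (b := 2 / 3)]
      apply intervalIntegral.integral_congr
      intro t ht
      rw [Set.uIcc_of_le (by norm_num)] at ht
      have e1 := stepFn_of_ge (k := 0) (t := t) (by linarith [ht.1])
      have e2 := stepFn_of_le (k := 2) (t := t) (by linarith [ht.2])
      have e3 : e.r t = c.r 1 := by
        have : e.r t = c.r (stepFn 0 t) := hrs t (by linarith [ht.2])
        rw [this, e1.1]
      simp only [hspeed, e1.2, e2.2, e3, mul_zero, add_zero, zero_add]
      -- Either the middle third stays on the core, where `sinh r = 0`, or there is no angle to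
      -- turn.
      rcases hθ with h0 | h0
      · simp [h0]
      · simp [h0]
    have i3 : ∫ t in (2 / 3 : ℝ)..1, cylSpeed e.r e.zeta e.theta t =
        ∫ t in (0 : ℝ)..1, cylSpeed d.r d.zeta d.theta t := by
      rw [← integral_reparam (continuous_cylSpeed d.r_smooth d.zeta_smooth d.theta_smooth) 2
        (2 / 3) 1 (by norm_num) (by norm_num)]
      apply intervalIntegral.integral_congr
      intro t ht
      rw [Set.uIcc_of_le (by norm_num)] at ht
      have e1 := stepFn_of_ge (k := 0) (t := t) (by linarith [ht.1])
      have e2 := stepFn_of_ge (k := 1) (t := t) (by linarith [ht.1])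
      have e3 : e.r t = d.r (stepFn 2 t) := hrs' t (by linarith [ht.1])
      simp only [hspeed, e1.2, e2.2, e3, mul_zero, add_zero, zero_mul, zero_add]
      exact sqrt_speed_mul (Real.cosh (d.r (stepFn 2 t)) ^ 2)
        (Real.sinh (d.r (stepFn 2 t)) ^ 2) (deriv d.r (stepFn 2 t))
        (deriv d.zeta (stepFn 2 t)) (deriv d.theta (stepFn 2 t)) (stepFn' 2 t)
        (stepFn'_nonneg 2 t)
    rw [i1, i2, i3, zero_add]

lemma HatH3.dist_triangle (x y z : HatH3) :
    HatH3.dist x z ≤ HatH3.dist x y + HatH3.dist y z := by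
  refine le_of_forall_pos_lt_add fun η hη => ?_
  obtain ⟨_, ⟨c, rfl, hc, rfl⟩, hcl⟩ := exists_lt_of_csInf_lt (HatH3.lengths_nonempty x y)
    (lt_add_of_pos_right (HatH3.dist x y) (half_pos hη))
  obtain ⟨_, ⟨d, hd, rfl, rfl⟩, hdl⟩ := exists_lt_of_csInf_lt (HatH3.lengths_nonempty y z)
    (lt_add_of_pos_right (HatH3.dist y z) (half_pos hη))
  obtain ⟨e, he1, he2, he3⟩ := CylCurve.exists_concat c d (hc.trans hd.symm)
  have := HatH3.dist_le_length e
  rw [he1, he2, he3] at this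
  linarith

/-! ### The distance formula in `Ĥ³` -/

/-- The distance of two points of `Ĥ³` in terms of cylindrical coordinates: when the angle between
them exceeds `π`, the shortest path runs through the core. -/
def cylDist (p q : Cyl) : ℝ :=
  dist (Hyp.pt p.r p.zeta 0) (Hyp.pt q.r q.zeta (min |p.theta - q.theta| Real.pi))

lemma cylDist_of_le {p q : Cyl} (h : |p.theta - q.theta| ≤ Real.pi) (a : ℝ) :
    cylDist p q =
      dist (Hyp.pt p.r p.zeta (p.theta + a)) (Hyp.pt q.r q.zeta (q.theta + a)) := by
  apply Hyp.dist_eq_of_minkowski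
  rw [← neg_inj, Hyp.minkowski_pt, Hyp.minkowski_pt, min_eq_left h, zero_sub, Real.cos_neg,
    Real.cos_abs, add_sub_add_right_eq_sub]

lemma cylDist_of_ge {p q : Cyl} (h : Real.pi ≤ |p.theta - q.theta|) :
    cylDist p q = dist (Hyp.pt p.r p.zeta 0) (Hyp.pt q.r q.zeta Real.pi) := by
  rw [cylDist, min_eq_right h]

lemma cosh_cylDist (p q : Cyl) :
    Real.cosh (cylDist p q) = Real.cosh p.r * Real.cosh q.r * Real.cosh (p.zeta - q.zeta) -
      Real.sinh p.r * Real.sinh q.r * Real.cos (min |p.theta - q.theta| Real.pi) := by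
  rw [cylDist, Hyp.cosh_dist_pt, zero_sub, Real.cos_neg]

lemma cylDist_nonneg (p q : Cyl) : 0 ≤ cylDist p q := dist_nonneg

lemma cylDist_congr {p p' q q' : Cyl} (hp : HatH3.mk p = HatH3.mk p')
    (hq : HatH3.mk q = HatH3.mk q') : cylDist p q = cylDist p' q' := by
  obtain ⟨h1, h2, h3⟩ := HatH3.mk_eq_mk.1 hp
  obtain ⟨k1, k2, k3⟩ := HatH3.mk_eq_mk.1 hq
  apply Hyp.dist_eq_of_minkowski
  rw [← neg_inj, Hyp.minkowski_pt, Hyp.minkowski_pt, ← h1, ← h2, ← k1, ← k2]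
  rcases h3 with h3 | h3
  · simp [h3]
  · rcases k3 with k3 | k3
    · simp [k3]
    · rw [h3, k3]

/-- If the total angle is at most `π`, this is the bound in `ℍ³`. Otherwise the curve is cut where
it has turned by exactly `π`, and the rest is pushed into the half plane of that angle, which only
shortens it. -/
lemma cylDist_le_length (c : CylCurve) :
    cylDist ⟨c.r 0, c.zeta 0, c.theta 0, c.r_nonneg 0 (by simp)⟩
      ⟨c.r 1, c.zeta 1, c.theta 1, c.r_nonneg 1 (by simp)⟩ ≤ c.length := by
  rcases le_total |c.theta 0 - c.theta 1| Real.pi with h | h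
  · rw [cylDist_of_le h 0]
    simp only [add_zero]
    exact Hyp.dist_le_length c.r_smooth c.zeta_smooth c.theta_smooth zero_le_one
  · rw [cylDist_of_ge h]
    obtain ⟨t, ht, hπ⟩ : ∃ t ∈ Set.Icc (0 : ℝ) 1, |c.theta 0 - c.theta t| = Real.pi := by
      have hcont : ContinuousOn (fun t => |c.theta 0 - c.theta t|) (Set.Icc 0 1) :=
        ((continuous_const.sub c.theta_smooth.continuous).abs).continuousOn
      have := intermediate_value_Icc zero_le_one hcont
      exact this ⟨by simpa using Real.pi_pos.le, h⟩
    have hint : ∀ a b : ℝ, IntervalIntegrable (cylSpeed c.r c.zeta c.theta)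
        MeasureTheory.volume a b := fun a b =>
      (continuous_cylSpeed c.r_smooth c.zeta_smooth c.theta_smooth).intervalIntegrable a b
    have h1 : dist (Hyp.pt (c.r 0) (c.zeta 0) 0) (Hyp.pt (c.r t) (c.zeta t) Real.pi) ≤
        ∫ s in (0 : ℝ)..t, cylSpeed c.r c.zeta c.theta s := by
      refine le_trans (le_of_eq ?_)
        (Hyp.dist_le_length c.r_smooth c.zeta_smooth c.theta_smooth ht.1)
      apply Hyp.dist_eq_of_minkowski
      rw [← neg_inj, Hyp.minkowski_pt, Hyp.minkowski_pt, ← Real.cos_abs (c.theta 0 - c.theta t),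
        hπ, zero_sub, Real.cos_neg]
    have h2 : dist (Hyp.pt (c.r t) (c.zeta t) Real.pi) (Hyp.pt (c.r 1) (c.zeta 1) Real.pi) ≤
        ∫ s in t..1, cylSpeed c.r c.zeta c.theta s := by
      refine (Hyp.dist_le_length c.r_smooth c.zeta_smooth
        (contDiff_const (c := Real.pi)) ht.2).trans ?_
      apply intervalIntegral.integral_mono_on ht.2
        ((continuous_cylSpeed c.r_smooth c.zeta_smooth contDiff_const).intervalIntegrable _ _)
        (hint _ _)
      intro s _
      apply Real.sqrt_le_sqrt
      simp only [deriv_const]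
      have : 0 ≤ Real.sinh (c.r s) ^ 2 * deriv c.theta s ^ 2 := by positivity
      linarith
    rw [CylCurve.length_eq, ← intervalIntegral.integral_add_adjacent_intervals (hint 0 t) (hint t 1)]
    exact le_trans (dist_triangle _ (Hyp.pt (c.r t) (c.zeta t) Real.pi) _) (add_le_add h1 h2)

lemma Hat.cylDist_le (p q : Cyl) : cylDist p q ≤ HatH3.dist (HatH3.mk p) (HatH3.mk q) := by
  apply le_csInf (HatH3.lengths_nonempty _ _)
  rintro L ⟨c, hc, hc', rfl⟩
  rw [← cylDist_congr hc hc']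
  exact cylDist_le_length c

/-! The coordinates of a point in the half space `x₂ > 0`. -/

/-- The radial coordinate. -/
def chartR (x : Fin 4 → ℝ) : ℝ := Real.arsinh (Real.sqrt (x 2 ^ 2 + x 3 ^ 2))

/-- The coordinate along the core. -/
def chartZ (x : Fin 4 → ℝ) : ℝ := Real.arsinh (x 1 / Real.sqrt (1 + (x 2 ^ 2 + x 3 ^ 2)))

/-- The angular coordinate. -/
def chartT (x : Fin 4 → ℝ) : ℝ := Real.arctan (x 3 / x 2)

lemma chartR_nonneg (x : Fin 4 → ℝ) : 0 ≤ chartR x :=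
  Real.arsinh_nonneg_iff.2 (Real.sqrt_nonneg _)

lemma chartR_pos {x : Fin 4 → ℝ} (h : 0 < x 2) : 0 < chartR x :=
  Real.arsinh_pos_iff.2 (Real.sqrt_pos.2 (by positivity))

lemma cosh_chart (x : H3) : Real.cosh (chartR x.1) * Real.cosh (chartZ x.1) = x.1 0 ∧
    Real.cosh (chartR x.1) * Real.sinh (chartZ x.1) = x.1 1 := by
  have hx := x.2.1
  simp only [minkowski] at hx
  have h0 : 0 ≤ x.1 2 ^ 2 + x.1 3 ^ 2 := by positivity
  have h1 : 0 < 1 + (x.1 2 ^ 2 + x.1 3 ^ 2) := by positivity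
  have h2 := Real.sqrt_pos.2 h1
  have hc : Real.cosh (chartR x.1) = √(1 + (x.1 2 ^ 2 + x.1 3 ^ 2)) := by
    rw [chartR, Real.cosh_arsinh, Real.sq_sqrt h0]
  constructor
  · rw [hc, chartZ, Real.cosh_arsinh, div_pow, Real.sq_sqrt h1.le, ← Real.sqrt_mul h1.le]
    rw [show (1 + (x.1 2 ^ 2 + x.1 3 ^ 2)) * (1 + x.1 1 ^ 2 / (1 + (x.1 2 ^ 2 + x.1 3 ^ 2))) =
      x.1 0 ^ 2 by field_simp; linarith]
    exact Real.sqrt_sq x.2.2.le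
  · rw [hc, chartZ, Real.sinh_arsinh]
    field_simp

lemma pt_chart {x : H3} (h : 0 < x.1 2) :
    Hyp.pt (chartR x.1) (chartZ x.1) (chartT x.1) = x := by
  have h0 : 0 < x.1 2 ^ 2 + x.1 3 ^ 2 := by positivity
  have hs := Real.sqrt_pos.2 h0
  have e1 : √(1 + (x.1 3 / x.1 2) ^ 2) = √(x.1 2 ^ 2 + x.1 3 ^ 2) / x.1 2 := by
    rw [Real.sqrt_eq_iff_mul_self_eq (by positivity) (by positivity)]
    rw [div_mul_div_comm, Real.mul_self_sqrt h0.le]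
    field_simp
  have hc := cosh_chart x
  apply Subtype.ext
  funext i
  fin_cases i
  · exact hc.1
  · exact hc.2
  · change Real.sinh (chartR x.1) * Real.cos (chartT x.1) = x.1 2
    rw [chartR, Real.sinh_arsinh, chartT, Real.cos_arctan, e1]
    field_simp
  · change Real.sinh (chartR x.1) * Real.sin (chartT x.1) = x.1 3
    rw [chartR, Real.sinh_arsinh, chartT, Real.sin_arctan, e1]
    field_simp

lemma chart_pt {r z t : ℝ} (hr : 0 < r) (ht : |t| < Real.pi / 2) :
    chartR (Hyp.pt r z t).1 = r ∧ chartZ (Hyp.pt r z t).1 = z ∧ chartT (Hyp.pt r z t).1 = t := by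
  have h1 : (Hyp.pt r z t).1 2 ^ 2 + (Hyp.pt r z t).1 3 ^ 2 = Real.sinh r ^ 2 := by
    change (Real.sinh r * Real.cos t) ^ 2 + (Real.sinh r * Real.sin t) ^ 2 = _
    linear_combination Real.sinh r ^ 2 * Real.sin_sq_add_cos_sq t
  have hs := Real.sinh_pos_iff.2 hr
  refine ⟨?_, ?_, ?_⟩
  · rw [chartR, h1, Real.sqrt_sq hs.le, Real.arsinh_sinh]
  · rw [chartZ, h1, add_comm, ← Real.cosh_sq, Real.sqrt_sq (Real.cosh_pos r).le]
    change Real.arsinh (Real.cosh r * Real.sinh z / Real.cosh r) = z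
    rw [mul_div_cancel_left₀ _ (Real.cosh_pos r).ne', Real.arsinh_sinh]
  · change Real.arctan (Real.sinh r * Real.sin t / (Real.sinh r * Real.cos t)) = t
    rw [mul_div_mul_left _ _ hs.ne', ← Real.tan_eq_sin_div_cos,
      Real.arctan_tan (abs_lt.1 ht).1 (abs_lt.1 ht).2]

lemma pt_two_pos {r z t : ℝ} (hr : 0 < r) (ht : |t| < Real.pi / 2) : 0 < (Hyp.pt r z t).1 2 :=
  mul_pos (Real.sinh_pos_iff.2 hr)
    (Real.cos_pos_of_mem_Ioo ⟨(abs_lt.1 ht).1, (abs_lt.1 ht).2⟩)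

/-- The cylindrical metric is the pullback of the Minkowski form. The speed can thus be read off
from the curve in `ℝ⁴`, without differentiating the chart. -/
lemma cylSpeed_eq_minkowski {r z θ : ℝ → ℝ} (hr : ContDiff ℝ 1 r) (hz : ContDiff ℝ 1 z)
    (hθ : ContDiff ℝ 1 θ) {v : Fin 4 → ℝ} {t : ℝ}
    (h : HasDerivAt (fun s => (Hyp.pt (r s) (z s) (θ s)).1) v t) :
    cylSpeed r z θ t = Real.sqrt (minkowski v v) := by
  rw [h.unique (Hyp.hasDerivAt_pt
      ((hr.differentiable one_ne_zero) t).hasDerivAt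
      ((hz.differentiable one_ne_zero) t).hasDerivAt
      ((hθ.differentiable one_ne_zero) t).hasDerivAt), Hyp.vel_self]
  rfl

lemma HatH3.dist_self (x : HatH3) : HatH3.dist x x = 0 := by
  obtain ⟨p, rfl⟩ := x.exists_mk
  apply le_antisymm _ (HatH3.dist_nonneg _ _)
  simpa using HatH3.dist_radial_le p.r p.r p.zeta p.theta p.r_nonneg p.r_nonneg

/-- The points on a geodesic between two points of the half space `x₂ > 0` lie in it. -/
lemma Hyp.geo_two_pos {a b : H3} (hab : a ≠ b) (ha : 0 < a.1 2) (hb : 0 < b.1 2)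
    {e : Fin 4 → ℝ} {he : minkowski e e = 1} {hae : minkowski a.1 e = 0}
    (h : ∀ t, (Hyp.geo a e he hae t).1 = (Real.sinh (dist a b))⁻¹ •
        (Real.sinh (dist a b - t) • a.1 + Real.sinh t • b.1)) {t : ℝ}
    (ht : t ∈ Set.Icc 0 (dist a b)) : 0 < (Hyp.geo a e he hae t).1 2 := by
  have hd : 0 < dist a b := dist_pos.2 hab
  rw [h]
  simp only [Pi.add_apply, Pi.smul_apply, smul_eq_mul]
  apply mul_pos (inv_pos.2 (Real.sinh_pos_iff.2 hd))
  have h1 : 0 ≤ Real.sinh (dist a b - t) := Real.sinh_nonneg_iff.2 (by linarith [ht.2])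
  rcases ht.1.eq_or_lt with h0 | h0
  · rw [← h0]
    simpa using mul_pos (Real.sinh_pos_iff.2 hd) ha
  · have h2 := mul_pos (Real.sinh_pos_iff.2 h0) hb
    have h3 := mul_nonneg h1 ha.le
    linarith

/-- Measuring angles from their mean puts both points in the half space `x₂ > 0`. It is convex and
avoids the core, so the geodesic of `ℍ³` has smooth cylindrical coordinates. -/
lemma Hat.dist_le_of_lt_pi {p q : Cyl} (hp : 0 < p.r) (hq : 0 < q.r)
    (h : |p.theta - q.theta| < Real.pi) :
    HatH3.dist (HatH3.mk p) (HatH3.mk q) ≤ cylDist p q := by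
  set m := (p.theta + q.theta) / 2 with hm
  have hpm : |p.theta - m| < Real.pi / 2 := by
    rw [hm, show p.theta - (p.theta + q.theta) / 2 = (p.theta - q.theta) / 2 by ring, abs_div,
      abs_two]; linarith
  have hqm : |q.theta - m| < Real.pi / 2 := by
    rw [hm, show q.theta - (p.theta + q.theta) / 2 = -((p.theta - q.theta) / 2) by ring, abs_neg,
      abs_div, abs_two]; linarith
  set a := Hyp.pt p.r p.zeta (p.theta - m) with ha
  set b := Hyp.pt q.r q.zeta (q.theta - m) with hb
  have ha2 : 0 < a.1 2 := pt_two_pos hp hpm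
  have hb2 : 0 < b.1 2 := pt_two_pos hq hqm
  have hcha := chart_pt (z := p.zeta) hp hpm
  have hchb := chart_pt (z := q.zeta) hq hqm
  rw [← ha] at hcha
  rw [← hb] at hchb
  rw [cylDist_of_le h.le (-m)]
  simp only [← sub_eq_add_neg, ← ha, ← hb]
  by_cases hab : a = b
  · have : HatH3.mk p = HatH3.mk q := by
      refine HatH3.mk_eq_mk.2 ⟨?_, ?_, Or.inr ?_⟩
      · rw [← hcha.1, ← hchb.1, hab]
      · rw [← hcha.2.1, ← hchb.2.1, hab]
      · have : p.theta - m = q.theta - m := by rw [← hcha.2.2, ← hchb.2.2, hab]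
        linarith
    rw [this, HatH3.dist_self]
    exact dist_nonneg
  obtain ⟨e, he, hae, hend, hgeo⟩ := Hyp.exists_geo hab
  set L := dist a b with hL
  have hL0 : 0 < L := dist_pos.2 hab
  -- The smooth step keeps the parameter in `[0, L]` for all real `t`, so the coordinates are `C¹`
  -- on the whole line, as `CylCurve` demands.
  set γ : ℝ → H3 := fun t => Hyp.geo a e he hae (L * stepFn 0 (t / 3)) with hγ
  have hmem : ∀ t, L * stepFn 0 (t / 3) ∈ Set.Icc 0 L := fun t =>
    ⟨mul_nonneg hL0.le (stepFn_mem _ _).1, by nlinarith [(stepFn_mem 0 (t / 3)).2]⟩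
  have hγ2 : ∀ t, 0 < (γ t).1 2 := fun t => Hyp.geo_two_pos hab ha2 hb2 hgeo (hmem t)
  have hγd : ContDiff ℝ 1 (fun t => (γ t).1) := by
    have h1 : ContDiff ℝ 1 (fun t : ℝ => L * stepFn 0 (t / 3)) :=
      contDiff_const.mul ((contDiff_stepFn 0).comp (contDiff_id.div_const 3))
    exact ((Real.contDiff_cosh.comp h1).smul contDiff_const).add
      ((Real.contDiff_sinh.comp h1).smul contDiff_const)
  have hγi : ∀ i, ContDiff ℝ 1 (fun t => (γ t).1 i) := fun i => contDiff_pi.1 hγd i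
  have hrad : ContDiff ℝ 1 (fun t => (γ t).1 2 ^ 2 + (γ t).1 3 ^ 2) :=
    ((hγi 2).pow 2).add ((hγi 3).pow 2)
  let c : CylCurve :=
    { r := fun t => chartR (γ t).1
      zeta := fun t => chartZ (γ t).1
      theta := fun t => m + chartT (γ t).1
      r_smooth := (hrad.sqrt fun t => by have := hγ2 t; positivity).arsinh
      zeta_smooth := ((hγi 1).div ((contDiff_const.add hrad).sqrt fun t => by positivity)
        fun t => by positivity).arsinh
      theta_smooth := contDiff_const.add
        (((hγi 3).div (hγi 2) fun t => (hγ2 t).ne').arctan)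
      r_nonneg := fun t _ => chartR_nonneg _ }
  have hγ0 : γ 0 = a := by
    have : stepFn 0 (0 / 3) = 0 := (stepFn_of_le (by norm_num)).1
    simp only [hγ, this, mul_zero, Hyp.geo_zero]
  have hγ1 : γ 1 = b := by
    have : stepFn 0 (1 / 3) = 1 := (stepFn_of_ge (by norm_num)).1
    simp only [hγ, this, mul_one, hend]
  have hsource : c.source = HatH3.mk p := HatH3.mk_eq_mk.2 ⟨by simp only [c, hγ0, hcha],
    by simp only [c, hγ0, hcha], Or.inr (by simp only [c, hγ0, hcha]; ring)⟩
  have htarget : c.target = HatH3.mk q := HatH3.mk_eq_mk.2 ⟨by simp only [c, hγ1, hchb],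
    by simp only [c, hγ1, hchb], Or.inr (by simp only [c, hγ1, hchb]; ring)⟩
  have := HatH3.dist_le_length c
  rw [hsource, htarget] at this
  refine this.trans (le_of_eq ?_)
  have h5 : ∀ t : ℝ, HasDerivAt (fun t : ℝ => stepFn 0 (t / 3)) (stepFn' 0 (t / 3) / 3) t := by
    intro t
    have h1 : HasDerivAt (fun t : ℝ => t / 3) (1 / 3) t := (hasDerivAt_id t).div_const 3
    have h2 := HasDerivAt.comp t (hasDerivAt_stepFn 0 (t / 3)) h1
    rw [mul_one_div] at h2
    exact h2
  have hspeed : ∀ t, cylSpeed c.r c.zeta c.theta t = L * (stepFn' 0 (t / 3) / 3) := by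
    intro t
    have h0 := (h5 t).const_mul L
    have h1 : cylSpeed c.r c.zeta c.theta t =
        cylSpeed (fun t => chartR (γ t).1) (fun t => chartZ (γ t).1)
          (fun t => chartT (γ t).1) t := by
      simp only [cylSpeed, c, deriv_const_add]
    have hθ : ContDiff ℝ 1 (fun t => chartT (γ t).1) :=
      ((hγi 3).div (hγi 2) fun t => (hγ2 t).ne').arctan
    have h2 : HasDerivAt (fun t => (γ t).1)
        ((Real.sinh (L * stepFn 0 (t / 3)) * (L * (stepFn' 0 (t / 3) / 3))) • a.1 +
        (Real.cosh (L * stepFn 0 (t / 3)) * (L * (stepFn' 0 (t / 3) / 3))) • e) t :=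
      (h0.cosh.smul_const a.1).add (h0.sinh.smul_const e)
    have h3 : (fun s => (Hyp.pt (chartR (γ s).1) (chartZ (γ s).1) (chartT (γ s).1)).1) =
        fun t => (γ t).1 := by
      funext s
      rw [pt_chart (hγ2 s)]
    rw [h1, cylSpeed_eq_minkowski c.r_smooth c.zeta_smooth hθ (h3 ▸ h2)]
    have h4 : 0 ≤ L * (stepFn' 0 (t / 3) / 3) :=
      mul_nonneg hL0.le (div_nonneg (stepFn'_nonneg _ _) (by norm_num))
    rw [← Real.sqrt_sq h4]
    congr 1
    rw [Real.sqrt_sq h4]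
    simp only [minkowski_add_left, minkowski_smul_left, minkowski_add_right,
      minkowski_smul_right, a.2.1, he, hae, minkowski_comm e a.1]
    linear_combination (L * (stepFn' 0 (t / 3) / 3)) ^ 2 * Real.cosh_sq (L * stepFn 0 (t / 3))
  rw [CylCurve.length_eq]
  simp only [hspeed]
  rw [intervalIntegral.integral_const_mul]
  rw [intervalIntegral.integral_eq_sub_of_hasDerivAt (fun t _ => h5 t)
    (((continuous_stepFn' 0).comp (continuous_id.div_const 3)).div_const 3 |>.intervalIntegrable _ _),
    (stepFn_of_le (k := 0) (t := 0 / 3) (by norm_num)).1,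
    (stepFn_of_ge (k := 0) (t := 1 / 3) (by norm_num)).1]
  ring

/-- Zero radii are reached by moving both points outward by `k` and letting `k → 0`. -/
lemma Hat.dist_le_of_lt_pi' {p q : Cyl} (h : |p.theta - q.theta| < Real.pi) :
    HatH3.dist (HatH3.mk p) (HatH3.mk q) ≤ cylDist p q := by
  have key : ∀ k : ℝ, 0 < k → HatH3.dist (HatH3.mk p) (HatH3.mk q) ≤
      k + Real.arcosh (Real.cosh (p.r + k) * Real.cosh (q.r + k) * Real.cosh (p.zeta - q.zeta) -
      Real.sinh (p.r + k) * Real.sinh (q.r + k) * Real.cos (min |p.theta - q.theta| Real.pi)) + k := by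
    intro k hk
    have hp : 0 < p.r + k := add_pos_of_nonneg_of_pos p.r_nonneg hk
    have hq : 0 < q.r + k := add_pos_of_nonneg_of_pos q.r_nonneg hk
    have h1 := HatH3.dist_radial_le p.r (p.r + k) p.zeta p.theta p.r_nonneg hp.le
    have h2 := HatH3.dist_radial_le (q.r + k) q.r q.zeta q.theta hq.le q.r_nonneg
    have h3 := Hat.dist_le_of_lt_pi (p := ⟨p.r + k, p.zeta, p.theta, hp.le⟩)
      (q := ⟨q.r + k, q.zeta, q.theta, hq.le⟩) hp hq h
    rw [add_sub_cancel_left, abs_of_pos hk] at h1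
    rw [sub_add_cancel_left, abs_neg, abs_of_pos hk] at h2
    rw [← Real.arcosh_cosh (cylDist_nonneg _ _), cosh_cylDist] at h3
    have h4 := HatH3.dist_triangle (HatH3.mk p) (HatH3.mk ⟨p.r + k, p.zeta, p.theta, hp.le⟩)
      (HatH3.mk q)
    have h5 := HatH3.dist_triangle (HatH3.mk ⟨p.r + k, p.zeta, p.theta, hp.le⟩)
      (HatH3.mk ⟨q.r + k, q.zeta, q.theta, hq.le⟩) (HatH3.mk q)
    simp only at h3
    linarith
  set F : ℝ → ℝ := fun k => Real.cosh (p.r + k) * Real.cosh (q.r + k) *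
    Real.cosh (p.zeta - q.zeta) -
      Real.sinh (p.r + k) * Real.sinh (q.r + k) * Real.cos (min |p.theta - q.theta| Real.pi) with hF
  have hFc : Continuous F := by
    have h1 : ∀ x : ℝ, Continuous fun k => Real.cosh (x + k) := fun x =>
      Real.continuous_cosh.comp (by fun_prop)
    have h2 : ∀ x : ℝ, Continuous fun k => Real.sinh (x + k) := fun x =>
      Real.continuous_sinh.comp (by fun_prop)
    exact (((h1 _).mul (h1 _)).mul continuous_const).sub
      (((h2 _).mul (h2 _)).mul continuous_const)
  have hF1 : ∀ k : ℝ, 1 ≤ F k := by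
    intro k
    have := H3.one_le (Hyp.pt (p.r + k) p.zeta 0)
      (Hyp.pt (q.r + k) q.zeta (min |p.theta - q.theta| Real.pi))
    rwa [Hyp.minkowski_pt, zero_sub, Real.cos_neg] at this
  have hlim : Filter.Tendsto (fun k => k + Real.arcosh (F k) + k) (nhdsWithin 0 (Set.Ioi 0))
      (nhds (0 + Real.arcosh (F 0) + 0)) := by
    have h1 : Continuous fun k => Real.arcosh (F k) :=
      Real.continuousOn_arcosh.comp_continuous hFc hF1
    exact (((continuous_id.add h1).add continuous_id).tendsto 0).mono_left nhdsWithin_le_nhds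
  have := ge_of_tendsto hlim (by filter_upwards [self_mem_nhdsWithin] with k hk using key k hk)
  rw [zero_add, add_zero] at this
  rw [← Real.arcosh_cosh (cylDist_nonneg _ _), cosh_cylDist]
  simpa [hF] using this

/-- For a point on the core, the angle may be changed to agree with the other one. For angles at
least `π`, the geodesic of `ℍ³` between points on opposite half planes meets the axis, and its two
halves lift to `Ĥ³` separately. -/
lemma Hat.dist_mk (p q : Cyl) : HatH3.dist (HatH3.mk p) (HatH3.mk q) = cylDist p q := by
  apply le_antisymm _ (Hat.cylDist_le p q)
  by_cases hp : p.r = 0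
  · have h1 : HatH3.mk p = HatH3.mk ⟨p.r, p.zeta, q.theta, p.r_nonneg⟩ :=
      HatH3.mk_eq_mk.2 ⟨rfl, rfl, Or.inl hp⟩
    rw [cylDist_congr h1 rfl, h1]
    exact Hat.dist_le_of_lt_pi' (by simpa using Real.pi_pos)
  by_cases hq : q.r = 0
  · have h1 : HatH3.mk q = HatH3.mk ⟨q.r, q.zeta, p.theta, q.r_nonneg⟩ :=
      HatH3.mk_eq_mk.2 ⟨rfl, rfl, Or.inl hq⟩
    rw [cylDist_congr rfl h1, h1]
    exact Hat.dist_le_of_lt_pi' (by simpa using Real.pi_pos)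
  rcases lt_or_ge |p.theta - q.theta| Real.pi with h | h
  · exact Hat.dist_le_of_lt_pi' h
  rw [cylDist_of_ge h]
  have hp0 := Real.sinh_pos_iff.2 (lt_of_le_of_ne p.r_nonneg (Ne.symm hp))
  have hq0 := Real.sinh_pos_iff.2 (lt_of_le_of_ne q.r_nonneg (Ne.symm hq))
  set a := Hyp.pt p.r p.zeta 0 with ha
  set b := Hyp.pt q.r q.zeta Real.pi with hb
  have ha2 : a.1 2 = Real.sinh p.r := by simp [ha, Hyp.pt]
  have hb2 : b.1 2 = -Real.sinh q.r := by simp [hb, Hyp.pt]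
  have ha3 : a.1 3 = 0 := by simp [ha, Hyp.pt]
  have hb3 : b.1 3 = 0 := by simp [hb, Hyp.pt]
  have hab : a ≠ b := by
    intro hab
    rw [hab] at ha2
    linarith
  obtain ⟨e, he, hae, hend, hgeo⟩ := Hyp.exists_geo hab
  obtain ⟨t, ht, ht2⟩ : ∃ t ∈ Set.Icc 0 (dist a b), (Hyp.geo a e he hae t).1 2 = 0 := by
    have hcont : ContinuousOn (fun t => (Hyp.geo a e he hae t).1 2) (Set.Icc 0 (dist a b)) := by
      apply Continuous.continuousOn
      simp only [Hyp.geo, Pi.add_apply, Pi.smul_apply, smul_eq_mul]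
      exact (Real.continuous_cosh.mul continuous_const).add
        (Real.continuous_sinh.mul continuous_const)
    apply intermediate_value_Icc' dist_nonneg hcont
    rw [hend, Hyp.geo_zero, ha2, hb2]
    exact ⟨by linarith, hp0.le⟩
  set g := Hyp.geo a e he hae t with hg
  have hg3 : g.1 3 = 0 := by
    rw [hg, hgeo]
    simp [ha3, hb3]
  have hgm := cosh_chart g
  have hg0 : chartR g.1 = 0 := by simp [chartR, ht2, hg3]
  rw [hg0] at hgm
  have hgpt : ∀ s, Hyp.pt 0 (chartZ g.1) s = g := by
    intro s
    apply Subtype.ext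
    funext i
    fin_cases i
    · exact hgm.1
    · exact hgm.2
    · simp [Hyp.pt, ht2]
    · simp [Hyp.pt, hg3]
  have d1 : cylDist p ⟨0, chartZ g.1, p.theta, le_rfl⟩ = dist a g := by
    rw [cylDist_of_le (by simpa using Real.pi_pos.le) (-p.theta)]
    simp only [add_neg_cancel, hgpt, ha]
  have d2 : cylDist ⟨0, chartZ g.1, q.theta, le_rfl⟩ q = dist g b := by
    rw [cylDist_of_le (by simpa using Real.pi_pos.le) (Real.pi - q.theta)]
    simp only [add_sub_cancel, hgpt, hb]
  have d3 : dist a g = t := by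
    have := Hyp.dist_geo a e he hae 0 t
    rwa [Hyp.geo_zero, zero_sub, abs_neg, abs_of_nonneg ht.1] at this
  have d4 : dist g b = dist a b - t := by
    have := Hyp.dist_geo a e he hae t (dist a b)
    rwa [hend, abs_sub_comm, abs_of_nonneg (sub_nonneg.2 ht.2)] at this
  have hcore : HatH3.mk ⟨0, chartZ g.1, p.theta, le_rfl⟩ =
      HatH3.mk ⟨0, chartZ g.1, q.theta, le_rfl⟩ := HatH3.mk_eq_mk.2 ⟨rfl, rfl, Or.inl rfl⟩
  have e1 := Hat.dist_le_of_lt_pi' (p := p) (q := ⟨0, chartZ g.1, p.theta, le_rfl⟩)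
    (by simpa using Real.pi_pos)
  have e2 := Hat.dist_le_of_lt_pi' (p := ⟨0, chartZ g.1, q.theta, le_rfl⟩) (q := q)
    (by simpa using Real.pi_pos)
  have e3 := HatH3.dist_triangle (HatH3.mk p) (HatH3.mk ⟨0, chartZ g.1, p.theta, le_rfl⟩)
    (HatH3.mk q)
  rw [d1, d3] at e1
  rw [d2, d4, ← hcore] at e2
  linarith

/-! ### `Ĥ³` as a metric space with an isometric action -/

lemma cylDist_comm (p q : Cyl) : cylDist p q = cylDist q p := by
  apply Hyp.dist_eq_of_minkowski
  rw [← neg_inj, Hyp.minkowski_pt, Hyp.minkowski_pt, abs_sub_comm q.theta,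
    ← neg_sub q.zeta, Real.cosh_neg]
  ring

lemma Hat.dist_comm (x y : HatH3) : HatH3.dist x y = HatH3.dist y x := by
  obtain ⟨p, rfl⟩ := x.exists_mk
  obtain ⟨q, rfl⟩ := y.exists_mk
  rw [Hat.dist_mk, Hat.dist_mk, cylDist_comm]

instance : PseudoMetricSpace HatH3 where
  dist := HatH3.dist
  dist_self := HatH3.dist_self
  dist_comm := Hat.dist_comm
  dist_triangle := HatH3.dist_triangle

lemma Hat.dist_def (x y : HatH3) : dist x y = HatH3.dist x y := rfl

lemma Hat.vadd_mk (z : ℂ) (p : Cyl) : z +ᵥ HatH3.mk p = HatH3.mk (Cyl.shift z p) := rfl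

lemma Hat.dist_vadd (z : ℂ) (x y : HatH3) : dist (z +ᵥ x) (z +ᵥ y) = dist x y := by
  obtain ⟨p, rfl⟩ := x.exists_mk
  obtain ⟨q, rfl⟩ := y.exists_mk
  rw [Hat.vadd_mk, Hat.vadd_mk, Hat.dist_def, Hat.dist_def, Hat.dist_mk, Hat.dist_mk, cylDist,
    cylDist]
  apply Hyp.dist_eq_of_minkowski
  rw [← neg_inj, Hyp.minkowski_pt, Hyp.minkowski_pt]
  simp only [Cyl.shift, add_sub_add_left_eq_sub]

lemma Hat.radius_mk (p : Cyl) : (HatH3.mk p).radius = p.r := rfl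

/-- The cosine of the angle, capped at `π`. -/
def capCos (t : ℝ) : ℝ := Real.cos (min |t| Real.pi)

lemma Hat.cosh_dist_mk (p q : Cyl) : Real.cosh (dist (HatH3.mk p) (HatH3.mk q)) =
    Real.cosh p.r * Real.cosh q.r * Real.cosh (p.zeta - q.zeta) -
      Real.sinh p.r * Real.sinh q.r * capCos (p.theta - q.theta) := by
  rw [Hat.dist_def, Hat.dist_mk, cosh_cylDist]; rfl

/-- The hyperbolic cosine of the displacement of `η` at distance `r` from the core. -/
def dispCosh (η : ℂ) (r : ℝ) : ℝ :=
  Real.cosh r ^ 2 * (Real.cosh η.re - capCos η.im) + capCos η.im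

/-- Writing `sinh² r = cosh² r - 1` makes the displacement affine in `cosh² r`. -/
lemma Hat.cosh_dist_vadd (η : ℂ) (x : HatH3) :
    Real.cosh (dist x (η +ᵥ x)) = dispCosh η x.radius := by
  obtain ⟨p, rfl⟩ := x.exists_mk
  rw [Hat.vadd_mk, Hat.cosh_dist_mk, Hat.radius_mk, dispCosh]
  simp only [Cyl.shift, sub_add_cancel_right, capCos, abs_neg, Real.cosh_neg]
  linear_combination (Real.cos (min |η.im| Real.pi)) * Real.cosh_sq p.r

/-! ### The quotient -/

variable {α l τ : ℝ}

lemma proj_eq_iff {a b : HatH3} : SolidTorus.proj α l τ a = SolidTorus.proj α l τ b ↔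
    ∃ η ∈ deckGroup α l τ, η +ᵥ b = a := by
  refine (Quotient.eq (r := AddAction.orbitRel (deckGroup α l τ) HatH3)).trans ?_
  constructor
  · rintro ⟨⟨η, hη⟩, h⟩
    exact ⟨η, hη, h⟩
  · rintro ⟨η, hη, h⟩
    exact ⟨⟨η, hη⟩, h⟩

lemma exists_proj (x : SolidTorus α l τ) : ∃ a, SolidTorus.proj α l τ a = x :=
  Quotient.exists_rep x

lemma radius_proj (a : HatH3) : (SolidTorus.proj α l τ a).radius = a.radius := rfl

lemma proj_dist_le (a b : HatH3) :
    SolidTorus.dist (SolidTorus.proj α l τ a) (SolidTorus.proj α l τ b) ≤ dist a b := by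
  refine csInf_le ⟨0, ?_⟩ ⟨a, b, rfl, rfl, rfl⟩
  rintro d ⟨a', b', -, -, rfl⟩
  exact HatH3.dist_nonneg a' b'

/-- The group acts by isometries, so a nearly optimal pair of lifts can be moved to start at the
given `a`. -/
lemma exists_lift_of_dist_lt {a : HatH3} {y : SolidTorus α l τ} {t : ℝ}
    (h : SolidTorus.dist (SolidTorus.proj α l τ a) y < t) :
    ∃ b, SolidTorus.proj α l τ b = y ∧ dist a b < t := by
  obtain ⟨y', hy'⟩ := exists_proj y
  obtain ⟨d, ⟨a', b', ha', hb', rfl⟩, hlt⟩ := exists_lt_of_csInf_lt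
    (by exact ⟨_, a, y', rfl, hy', rfl⟩) h
  obtain ⟨η, hη, h1⟩ := proj_eq_iff.1 ha'.symm
  refine ⟨η +ᵥ b', ?_, ?_⟩
  · rw [← hb']
    exact proj_eq_iff.2 ⟨η, hη, rfl⟩
  · rw [← h1, Hat.dist_vadd]
    exact hlt

/-! ### Embedded balls -/

/-- A map onto the solid torus which induces its metric as the distance between fibres. -/
structure IsMetricQuotient {X : Type*} [PseudoMetricSpace X] (π : X → SolidTorus α l τ) : Prop where
  dist_le : ∀ a b, SolidTorus.dist (π a) (π b) ≤ dist a b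
  exists_lift : ∀ a y t, SolidTorus.dist (π a) y < t → ∃ b, π b = y ∧ dist a b < t

/-- Distinct points of a fibre have total distance at least `2s` from `P`. -/
def FibreSeparated {X : Type*} [PseudoMetricSpace X] (π : X → SolidTorus α l τ) (P : X)
    (s : ℝ) : Prop :=
  ∀ b b', π b = π b' → b ≠ b' → 2 * s ≤ dist P b + dist P b'

section quotient

variable {X : Type*} [PseudoMetricSpace X] {π : X → SolidTorus α l τ}

/-- A smaller distance downstairs would give a second point `b'` of the fibre of `b`, closer to `a`
than `b` is. Then `d(x,b) + d(x,b') < 2 d(x,P) + 4t ≤ 2s`, against the separation. -/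
lemma IsMetricQuotient.isometric (hπ : IsMetricQuotient π) {x P a b : X} {s t : ℝ}
    (hs : FibreSeparated π x s) (ht : 2 * t ≤ s - dist x P) (ha : dist P a < t)
    (hb : dist P b < t) : SolidTorus.dist (π a) (π b) = dist a b := by
  apply le_antisymm (hπ.dist_le a b)
  by_contra! hlt
  obtain ⟨b', hb', hd⟩ := hπ.exists_lift a (π b) _ hlt
  have hne : b ≠ b' := by
    rintro rfl
    exact lt_irrefl _ hd
  have h1 := hs b b' hb'.symm hne
  have h2 := dist_triangle x P b
  have h3 := dist_triangle x P a
  have h4 := dist_triangle x a b'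
  have h5 := dist_triangle_left a b P
  linarith

lemma IsMetricQuotient.image_ball (hπ : IsMetricQuotient π) (P : X) (t : ℝ) :
    π '' {a | dist P a < t} = SolidTorus.ball (π P) t := by
  ext y
  constructor
  · rintro ⟨a, ha, rfl⟩
    exact (hπ.dist_le P a).trans_lt ha
  · intro hy
    obtain ⟨b, rfl, hb⟩ := hπ.exists_lift P y t hy
    exact ⟨b, hb, rfl⟩

/-- Two points of the open `s`-ball upstairs have total distance below `2s` from its center, so
separation makes `π` injective there. Near an inner point it is isometric on balls of half the
remaining radius. -/
lemma IsMetricQuotient.isEmbeddedBall (hπ : IsMetricQuotient π) {x : X} {s : ℝ}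
    (hs : FibreSeparated π x s) {j : H3 → X} (hj0 : j H3.origin = x)
    (hj : ∀ p q, dist H3.origin p < s → dist H3.origin q < s → dist (j p) (j q) = dist p q)
    (hsurj : ∀ a, dist x a < s → ∃ p, dist H3.origin p < s ∧ j p = a) :
    (π x).IsEmbeddedBall s := by
  have hball : ∀ p, dist H3.origin p < s → dist x (j p) = dist H3.origin p := by
    intro p hp
    rw [← hj0]
    exact hj _ _ (by rw [dist_self]; exact dist_nonneg.trans_lt hp) hp
  have himage : ∀ p t, dist H3.origin p + t ≤ s →
      j '' H3.ball p t = {a | dist (j p) a < t} := by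
    intro p t hpt
    ext a
    constructor
    · rintro ⟨q, hq, rfl⟩
      have hq' : dist p q < t := hq
      have h1 := dist_triangle H3.origin p q
      have h2 : 0 ≤ dist p q := dist_nonneg
      change dist (j p) (j q) < t
      rw [hj p q (by linarith) (by linarith)]
      exact hq'
    · intro ha
      have ha' : dist (j p) a < t := ha
      have h0 : 0 ≤ dist (j p) a := dist_nonneg
      have hp : dist H3.origin p < s := by linarith
      have h1 := dist_triangle x (j p) a
      rw [hball p hp] at h1
      obtain ⟨q, hq, rfl⟩ := hsurj a (by linarith)
      refine ⟨q, ?_, rfl⟩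
      rw [hj p q hp hq] at ha'
      exact ha'
  have hjx : j '' H3.ball H3.origin s = {a | dist x a < s} := by
    rw [himage _ _ (by rw [dist_self, zero_add]), hj0]
  refine ⟨π ∘ j, by rw [Function.comp_apply, hj0], ⟨?_, ?_, ?_⟩, ?_⟩
  · rw [Set.mapsTo_iff_image_subset, Set.image_comp, hjx, hπ.image_ball]
  · intro p hp q hq hpq
    by_contra hne
    have hp' : dist H3.origin p < s := hp
    have hq' : dist H3.origin q < s := hq
    have hpq0 := dist_pos.2 hne
    rw [← hj p q hp' hq'] at hpq0
    have := hs (j p) (j q) hpq (fun h => by rw [h, dist_self] at hpq0; exact lt_irrefl _ hpq0)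
    rw [hball p hp', hball q hq'] at this
    linarith
  · rw [Set.SurjOn, Set.image_comp, hjx, hπ.image_ball]
  · intro p hp
    have hp' : dist H3.origin p < s := hp
    refine ⟨(s - dist H3.origin p) / 2, by linarith, ?_, ?_, ?_⟩
    · intro q hq
      have hq' : dist p q < (s - dist H3.origin p) / 2 := hq
      have := dist_triangle H3.origin p q
      change dist H3.origin q < s
      linarith
    · rw [Set.image_comp, himage _ _ (by linarith), hπ.image_ball]
      rfl
    · intro q hq q' hq'
      have h1 : dist p q < (s - dist H3.origin p) / 2 := hq
      have h2 : dist p q' < (s - dist H3.origin p) / 2 := hq'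
      have t1 := dist_triangle H3.origin p q
      have t2 := dist_triangle H3.origin p q'
      have e1 := hj p q hp' (by linarith)
      have e2 := hj p q' hp' (by linarith)
      have e3 := hj q q' (by linarith) (by linarith)
      refine (hπ.isometric hs (P := j p) (t := (s - dist H3.origin p) / 2)
        (by rw [hball p hp']; linarith) (by rw [e1]; exact h1) (by rw [e2]; exact h2)).trans e3

/-- If `d < 2s`, the projected geodesic is a loop inside the embedded ball. Its preimage `γ` under
`f` is a loop in `ℍ³`, locally geodesic because `π` and `f` are both local isometries, and no such
loop exists. -/
lemma IsMetricQuotient.le_of_isEmbeddedBall (hπ : IsMetricQuotient π) {c : ℝ → X} {d s : ℝ}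
    (hd : 0 < d) (hc : ∀ t ∈ Set.Icc 0 d, ∀ t' ∈ Set.Icc 0 d, dist (c t) (c t') = |t - t'|)
    (hend : π (c 0) = π (c d))
    (hloc : ∀ t ∈ Set.Icc 0 d, ∃ e > 0, FibreSeparated π (c t) e)
    (hs : (π (c 0)).IsEmbeddedBall s) : 2 * s ≤ d := by
  by_contra! hlt
  obtain ⟨f, hf0, hbij, hiso⟩ := hs
  have hmem : ∀ t ∈ Set.Icc 0 d, π (c t) ∈ SolidTorus.ball (π (c 0)) s := by
    intro t ht
    -- The first half is within `d / 2 < s` of `c 0`, the second within `d / 2` of `c d`, which has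
    -- the same image.
    rcases le_total t (d / 2) with h | h
    · refine lt_of_le_of_lt (hπ.dist_le _ _) ?_
      rw [hc 0 ⟨le_rfl, hd.le⟩ t ht, zero_sub, abs_neg, abs_of_nonneg ht.1]
      linarith
    · rw [hend]
      refine lt_of_le_of_lt (hπ.dist_le _ _) ?_
      rw [hc d ⟨hd.le, le_rfl⟩ t ht, abs_of_nonneg (sub_nonneg.2 ht.2)]
      linarith
  have hex : ∀ t, ∃ p, t ∈ Set.Icc 0 d → p ∈ H3.ball H3.origin s ∧ f p = π (c t) := by
    intro t
    by_cases ht : t ∈ Set.Icc 0 d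
    · obtain ⟨p, hp, hfp⟩ := hbij.surjOn (hmem t ht)
      exact ⟨p, fun _ => ⟨hp, hfp⟩⟩
    · exact ⟨H3.origin, fun h => absurd h ht⟩
  choose γ hγ using hex
  have h0 : (0 : ℝ) ∈ Set.Icc 0 d := ⟨le_rfl, hd.le⟩
  have h1 : d ∈ Set.Icc 0 d := ⟨hd.le, le_rfl⟩
  have hloop : γ 0 = γ d := by
    apply hbij.injOn (hγ 0 h0).1 (hγ d h1).1
    rw [(hγ 0 h0).2, (hγ d h1).2, hend]
  refine Hyp.no_geodesic_loop hd (fun t ht => ?_) hloop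
  obtain ⟨e, he, hsep⟩ := hloc t ht
  obtain ⟨u, hu, hsub, himg, hisom⟩ := hiso (γ t) (hγ t ht).1
  have key : ∀ s' ∈ Set.Icc 0 d, |s' - t| < u → γ s' ∈ H3.ball (γ t) u := by
    intro s' hs' hlt'
    have : π (c s') ∈ SolidTorus.ball (f (γ t)) u := by
      rw [(hγ t ht).2]
      refine lt_of_le_of_lt (hπ.dist_le _ _) ?_
      rwa [hc t ht s' hs', abs_sub_comm]
    rw [← himg] at this
    obtain ⟨q, hq, hfq⟩ := this
    have : q = γ s' := hbij.injOn (hsub hq) (hγ s' hs').1 (by rw [hfq, (hγ s' hs').2])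
    rwa [← this]
  refine ⟨min u (e / 2), lt_min hu (half_pos he), fun a ha b hb hat hbt => ?_⟩
  have e1 := hisom _ (key a ha (hat.trans_le (min_le_left _ _))) _
    (key b hb (hbt.trans_le (min_le_left _ _)))
  rw [(hγ a ha).2, (hγ b hb).2] at e1
  rw [Hyp.dist_def, ← e1, ← hc a ha b hb]
  refine hπ.isometric hsep (P := c t) (t := e / 2) (by rw [dist_self]; linarith) ?_ ?_
  · rw [hc t ht a ha, abs_sub_comm]; exact hat.trans_le (min_le_right _ _)
  · rw [hc t ht b hb, abs_sub_comm]; exact hbt.trans_le (min_le_right _ _)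

end quotient

/-! ### Capped cosine and displacements -/

lemma capCos_le_one (t : ℝ) : capCos t ≤ 1 := Real.cos_le_one _

lemma neg_one_le_capCos (t : ℝ) : -1 ≤ capCos t := Real.neg_one_le_cos _

lemma capCos_zero : capCos 0 = 1 := by simp [capCos, Real.pi_pos.le]

lemma capCos_of_le {t : ℝ} (h : |t| ≤ Real.pi) : capCos t = Real.cos t := by
  rw [capCos, min_eq_left h, Real.cos_abs]

lemma capCos_of_ge {t : ℝ} (h : Real.pi ≤ |t|) : capCos t = -1 := by
  rw [capCos, min_eq_right h, Real.cos_pi]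

lemma capCos_le_of_abs_le {s t : ℝ} (h : |s| ≤ |t|) : capCos t ≤ capCos s :=
  Real.cos_le_cos_of_nonneg_of_le_pi (le_min (abs_nonneg _) Real.pi_pos.le) (min_le_right _ _)
    (min_le_min_right _ h)

lemma capCos_lt_of_abs_lt {s t : ℝ} (h : |s| < |t|) (hs : |s| < Real.pi) :
    capCos t < capCos s := by
  refine Real.cos_lt_cos_of_nonneg_of_le_pi (le_min (abs_nonneg _) Real.pi_pos.le)
    (min_le_right _ _) ?_
  rw [min_eq_left hs.le]
  exact lt_min h hs

lemma capCos_lt_one {t : ℝ} (h : t ≠ 0) : capCos t < 1 := by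
  rw [← capCos_zero]
  exact capCos_lt_of_abs_lt (by simpa using h) (by simpa using Real.pi_pos)

lemma abs_lt_of_capCos_pos {t : ℝ} (h : 0 < capCos t) : |t| < Real.pi / 2 := by
  by_contra! hge
  have h1 := capCos_le_of_abs_le (s := Real.pi / 2) (t := t)
    (by rwa [abs_of_pos (by linarith [Real.pi_pos])])
  rw [capCos_of_le (t := Real.pi / 2)
    (by rw [abs_of_pos (by linarith [Real.pi_pos])]; linarith [Real.pi_pos]),
    Real.cos_pi_div_two] at h1
  linarith

lemma cosh_re_le_dispCosh (η : ℂ) (r : ℝ) : Real.cosh η.re ≤ dispCosh η r := by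
  unfold dispCosh
  rw [Real.cosh_sq r]
  have h1 := Real.one_le_cosh η.re
  have h2 := capCos_le_one η.im
  nlinarith [mul_nonneg (sq_nonneg (Real.sinh r)) (sub_nonneg.2 (h2.trans h1))]

lemma cosh_le_cosh_iff {x y : ℝ} (hx : 0 ≤ x) (hy : 0 ≤ y) :
    Real.cosh x ≤ Real.cosh y ↔ x ≤ y := by
  rw [Real.cosh_le_cosh, abs_of_nonneg hx, abs_of_nonneg hy]

lemma cosh_lt_cosh_iff {x y : ℝ} (hx : 0 ≤ x) (hy : 0 ≤ y) :
    Real.cosh x < Real.cosh y ↔ x < y := by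
  rw [Real.cosh_lt_cosh, abs_of_nonneg hx, abs_of_nonneg hy]

lemma mem_deckGroup {η : ℂ} : η ∈ deckGroup α l τ ↔
    ∃ m k : ℤ, η.re = k * l ∧ η.im = m * α + k * τ := by
  rw [deckGroup, AddSubgroup.mem_closure_pair]
  constructor
  · rintro ⟨m, k, rfl⟩
    exact ⟨m, k, by simp, by simp⟩
  · rintro ⟨m, k, h1, h2⟩
    refine ⟨m, k, ?_⟩
    apply Complex.ext
    · simp [h1]
    · simp [h2]

lemma abs_re_of_mem_deckGroup (hl : 0 < l) {η : ℂ} (hη : η ∈ deckGroup α l τ) (h : η.re ≠ 0) :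
    l ≤ |η.re| := by
  obtain ⟨m, k, h1, -⟩ := mem_deckGroup.1 hη
  have hk : k ≠ 0 := by
    rintro rfl
    simp at h1
    exact h h1
  rw [h1, abs_mul, abs_of_pos hl]
  have : (1 : ℝ) ≤ |(k : ℝ)| := by exact_mod_cast Int.one_le_abs hk
  nlinarith

lemma abs_im_of_mem_deckGroup (hα : 0 < α) (hl : 0 < l) {η : ℂ} (hη : η ∈ deckGroup α l τ)
    (h : η ≠ 0) (h0 : η.re = 0) : α ≤ |η.im| := by
  obtain ⟨m, k, h1, h2⟩ := mem_deckGroup.1 hη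
  have hk : k = 0 := by
    rw [h0] at h1
    have := (mul_eq_zero.1 h1.symm).resolve_right hl.ne'
    exact_mod_cast this
  subst hk
  have hm : m ≠ 0 := by
    rintro rfl
    exact h (Complex.ext (by simpa using h0) (by simpa using h2))
  rw [h2, Int.cast_zero, zero_mul, add_zero, abs_mul, abs_of_pos hα]
  have : (1 : ℝ) ≤ |(m : ℝ)| := by exact_mod_cast Int.one_le_abs hm
  nlinarith

lemma le_dist_vadd_of_re_ne_zero (hl : 0 < l) (x : HatH3) {η : ℂ}
    (hη : η ∈ deckGroup α l τ) (hre : η.re ≠ 0) : l ≤ dist x (η +ᵥ x) := by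
  rw [← cosh_le_cosh_iff hl.le dist_nonneg, Hat.cosh_dist_vadd]
  refine le_trans ?_ (cosh_re_le_dispCosh _ _)
  rw [← Real.cosh_abs η.re, cosh_le_cosh_iff hl.le (abs_nonneg _)]
  exact abs_re_of_mem_deckGroup hl hη hre

/-- Away from the core, the displacements of the nontrivial elements are bounded below. -/
lemma exists_displacement_bound (hα : 0 < α) (hl : 0 < l) {x : HatH3} (hx : 0 < x.radius) :
    ∃ e > 0, ∀ η ∈ deckGroup α l τ, η ≠ 0 → 2 * e ≤ dist x (η +ᵥ x) := by
  have hc := capCos_lt_one hα.ne'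
  have hs := Real.sinh_pos_iff.2 hx
  set A := 1 + Real.sinh x.radius ^ 2 * (1 - capCos α) with hA
  have hA1 : 1 < A := by
    have : 0 < Real.sinh x.radius ^ 2 * (1 - capCos α) := mul_pos (by positivity) (by linarith)
    linarith
  refine ⟨min l (Real.arcosh A) / 2, half_pos (lt_min hl (Real.arcosh_pos hA1)), ?_⟩
  intro η hη hne
  rw [mul_div_cancel₀ _ two_ne_zero]
  by_cases h0 : η.re = 0
  · refine (min_le_right _ _).trans ?_
    rw [← cosh_le_cosh_iff (Real.arcosh_nonneg hA1.le) dist_nonneg, Real.cosh_arcosh hA1.le,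
      Hat.cosh_dist_vadd, dispCosh, h0, Real.cosh_zero, Real.cosh_sq]
    have h1 := abs_im_of_mem_deckGroup hα hl hη hne h0
    have h2 := capCos_le_of_abs_le (s := α) (t := η.im) (by rwa [abs_of_pos hα])
    have h3 := mul_le_mul_of_nonneg_left h2 (sq_nonneg (Real.sinh x.radius))
    rw [hA]; linarith
  · exact (min_le_left _ _).trans (le_dist_vadd_of_re_ne_zero hl x hη h0)

lemma isMetricQuotient_proj : IsMetricQuotient (SolidTorus.proj α l τ) where
  dist_le := proj_dist_le
  exists_lift _ _ _ h := exists_lift_of_dist_lt h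

/-- If `b = η b'`, then `d(x, η x) ≤ d(x, b) + d(η b', η x) = d(x, b) + d(x, b')`. -/
lemma fibreSeparated_proj {x : HatH3} {s : ℝ}
    (h : ∀ η ∈ deckGroup α l τ, η ≠ 0 → 2 * s ≤ dist x (η +ᵥ x)) :
    FibreSeparated (SolidTorus.proj α l τ) x s := by
  intro b b' hb hne
  obtain ⟨η, hη, rfl⟩ := proj_eq_iff.1 hb
  have h0 : η ≠ 0 := by
    rintro rfl
    exact hne (zero_vadd ℂ b')
  have h1 := h η hη h0
  have h2 := dist_triangle x (η +ᵥ b') (η +ᵥ x)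
  rw [Hat.dist_vadd, dist_comm b' x] at h2
  linarith

/-! ### The chart of a half space -/

/-- The point of `Ĥ³` over a point of the half space `x₂ > 0` of `ℍ³`, with angles measured
from `m`. -/
def chartLift (m : ℝ) (x : H3) : HatH3 :=
  HatH3.mk ⟨chartR x.1, chartZ x.1, m + chartT x.1, chartR_nonneg _⟩

lemma dist_chartLift (m : ℝ) {x y : H3} (hx : 0 < x.1 2) (hy : 0 < y.1 2) :
    dist (chartLift m x) (chartLift m y) = dist x y := by
  rw [Hat.dist_def, chartLift, chartLift, Hat.dist_mk, cylDist_of_le _ (-m)]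
  · simp only [add_neg_cancel_comm, pt_chart hx, pt_chart hy]
  · simp only [add_sub_add_left_eq_sub, chartT]
    have h1 := Real.arctan_lt_pi_div_two (x.1 3 / x.1 2)
    have h2 := Real.neg_pi_div_two_lt_arctan (x.1 3 / x.1 2)
    have h3 := Real.arctan_lt_pi_div_two (y.1 3 / y.1 2)
    have h4 := Real.neg_pi_div_two_lt_arctan (y.1 3 / y.1 2)
    rw [abs_le]
    constructor <;> linarith

lemma chartLift_pt (m : ℝ) {r z t : ℝ} (hr : 0 < r) (ht : |t| < Real.pi / 2) :
    chartLift m (Hyp.pt r z t) = HatH3.mk ⟨r, z, m + t, hr.le⟩ := by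
  obtain ⟨h1, h2, h3⟩ := chart_pt (z := z) hr ht
  exact HatH3.mk_eq_mk.2 ⟨h1, h2, Or.inr (by simp only [h3])⟩

/-! ### Embedded balls in singular tori -/

/-- With rotation less than `π`, the geodesic from `x` to `η x` avoids the core, as seen in the half
space chart centered at the mean angle. Each of its points thus has displacements bounded below, and
the loop argument applies. -/
lemma dist_le_of_isEmbeddedBall_of_im_lt (hα : 0 < α) (hl : 0 < l) {x : HatH3}
    (hx : 0 < x.radius) {s : ℝ} (hs : (SolidTorus.proj α l τ x).IsEmbeddedBall s) {η : ℂ}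
    (hη : η ∈ deckGroup α l τ) (hne : η ≠ 0) (him : |η.im| < Real.pi) :
    2 * s ≤ dist x (η +ᵥ x) := by
  have hd : 0 < dist x (η +ᵥ x) := by
    obtain ⟨e, he, h⟩ := exists_displacement_bound (τ := τ) hα hl hx
    have := h η hη hne
    linarith
  obtain ⟨⟨r, z, t, hr0⟩, rfl⟩ := x.exists_mk
  have hr : 0 < r := hx
  set a := Hyp.pt r z (-(η.im / 2)) with ha
  set b := Hyp.pt r (η.re + z) (η.im / 2) with hb
  have hi : |η.im / 2| < Real.pi / 2 := by rw [abs_div, abs_two]; linarith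
  have hi' : |-(η.im / 2)| < Real.pi / 2 := by rwa [abs_neg]
  have ha2 : 0 < a.1 2 := pt_two_pos hr hi'
  have hb2 : 0 < b.1 2 := pt_two_pos hr hi
  have hla : chartLift (t + η.im / 2) a = HatH3.mk ⟨r, z, t, hr0⟩ := by
    rw [ha, chartLift_pt _ hr hi']
    exact HatH3.mk_eq_mk.2 ⟨rfl, rfl, Or.inr (by simp)⟩
  have hlb : chartLift (t + η.im / 2) b = η +ᵥ HatH3.mk ⟨r, z, t, hr0⟩ := by
    rw [hb, chartLift_pt _ hr hi]
    exact HatH3.mk_eq_mk.2 ⟨rfl, rfl, Or.inr (by simp only [Cyl.shift]; ring)⟩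
  have hab : dist a b = dist (HatH3.mk ⟨r, z, t, hr0⟩) (η +ᵥ HatH3.mk ⟨r, z, t, hr0⟩) := by
    rw [← hlb, ← hla, dist_chartLift _ ha2 hb2]
  rw [← hab] at hd ⊢
  obtain ⟨e, he, hae, hend, hgeo⟩ := Hyp.exists_geo (dist_pos.1 hd)
  have hpos : ∀ u ∈ Set.Icc 0 (dist a b), 0 < (Hyp.geo a e he hae u).1 2 :=
    fun u hu => Hyp.geo_two_pos (dist_pos.1 hd) ha2 hb2 hgeo hu
  have hc0 : chartLift (t + η.im / 2) (Hyp.geo a e he hae 0) = HatH3.mk ⟨r, z, t, hr0⟩ := by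
    rw [Hyp.geo_zero, hla]
  refine isMetricQuotient_proj.le_of_isEmbeddedBall (π := SolidTorus.proj α l τ)
    (c := fun u => chartLift (t + η.im / 2) (Hyp.geo a e he hae u)) hd ?_ ?_ ?_ ?_
  · intro u hu u' hu'
    rw [dist_chartLift _ (hpos u hu) (hpos u' hu'), Hyp.dist_geo]
  · simp only [hend, hc0, hlb]
    exact (proj_eq_iff.2 ⟨η, hη, rfl⟩).symm
  · intro u hu
    obtain ⟨e', he', h⟩ := exists_displacement_bound (τ := τ) hα hl
      (x := chartLift (t + η.im / 2) (Hyp.geo a e he hae u)) (chartR_pos (hpos u hu))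
    exact ⟨e', he', fibreSeparated_proj h⟩
  · simp only [hc0]
    exact hs

lemma Hat.radius_sub_le_dist (a b : HatH3) : b.radius - a.radius ≤ dist a b := by
  obtain ⟨p, rfl⟩ := a.exists_mk
  obtain ⟨q, rfl⟩ := b.exists_mk
  rw [Hat.radius_mk, Hat.radius_mk]
  refine (le_abs_self _).trans ?_
  rw [← cosh_le_cosh_iff (abs_nonneg _) dist_nonneg, Hat.cosh_dist_mk, Real.cosh_abs,
    Real.cosh_sub]
  have h1 := Real.one_le_cosh (p.zeta - q.zeta)
  have h2 := capCos_le_one (p.theta - q.theta)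
  have h3 : 0 ≤ Real.cosh p.r * Real.cosh q.r :=
    (mul_pos (Real.cosh_pos _) (Real.cosh_pos _)).le
  have h4 : 0 ≤ Real.sinh p.r * Real.sinh q.r :=
    mul_nonneg (Real.sinh_nonneg_iff.2 p.r_nonneg) (Real.sinh_nonneg_iff.2 q.r_nonneg)
  nlinarith [mul_le_mul_of_nonneg_left h1 h3, mul_le_mul_of_nonneg_left h2 h4]

/-- A ball isometric to a ball of `ℍ³` does not reach a singular core. -/
lemma le_radius_of_isEmbeddedBall (hα : 0 < α) (hα' : α < 2 * Real.pi) {x : HatH3} {s : ℝ}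
    (hs : (SolidTorus.proj α l τ x).IsEmbeddedBall s) : s ≤ x.radius := by
  by_contra! hlt
  obtain ⟨f, hf0, hbij, hiso⟩ := hs
  obtain ⟨⟨r, z, θ, hr⟩, rfl⟩ := x.exists_mk
  have hlt' : r < s := hlt
  set c : HatH3 := HatH3.mk ⟨0, z, θ, le_rfl⟩ with hc
  have hcball : SolidTorus.proj α l τ c ∈
      SolidTorus.ball (SolidTorus.proj α l τ (HatH3.mk ⟨r, z, θ, hr⟩)) s := by
    refine lt_of_le_of_lt (proj_dist_le _ _) (lt_of_le_of_lt ?_ hlt')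
    have := HatH3.dist_radial_le r 0 z θ hr le_rfl
    rwa [zero_sub, abs_neg, abs_of_nonneg hr] at this
  obtain ⟨p, hp, hfp⟩ := hbij.surjOn hcball
  obtain ⟨t, ht, hsub, himg, hisom⟩ := hiso p hp
  set h := t / 2 with hh
  have hh0 : 0 < h := half_pos ht
  set y : HatH3 := HatH3.mk ⟨h, z, θ, hh0.le⟩ with hy
  have hcy : dist c y ≤ h := by
    have := HatH3.dist_radial_le 0 h z θ le_rfl hh0.le
    rwa [sub_zero, abs_of_pos hh0] at this
  have hyball : SolidTorus.proj α l τ y ∈ SolidTorus.ball (f p) t := by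
    rw [hfp]
    exact lt_of_le_of_lt (proj_dist_le _ _) (by linarith)
  rw [← himg] at hyball
  obtain ⟨q, hq, hfq⟩ := hyball
  have hpp : p ∈ H3.ball p t := by
    change H3.dist p p < t
    rw [H3.dist_self]; exact ht
  have d1 := hisom p hpp q hq
  rw [hfp, hfq] at d1
  set h0 := H3.dist p q with hh0'
  have hle : h0 ≤ h := d1 ▸ (proj_dist_le c y).trans hcy
  -- Every lift of the image of `y` has radius `h`, so none is closer to the core.
  have hge : h ≤ h0 := by
    refine le_of_forall_gt fun k hk => ?_
    rw [← d1] at hk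
    obtain ⟨b, hb, hbk⟩ := exists_lift_of_dist_lt hk
    have h1 := Hat.radius_sub_le_dist c b
    have h2 : b.radius = h := by rw [← radius_proj (α := α) (l := l) (τ := τ), hb]; rfl
    have h3 : c.radius = 0 := rfl
    rw [h2, h3, sub_zero] at h1
    exact h1.trans_lt hbk
  have hhh : h0 = h := le_antisymm hle hge
  have hpq : p ≠ q := by
    rintro rfl
    rw [hh0', H3.dist_self] at hhh
    linarith
  -- In `ℍ³` a point opposite to `q` across `p` exists. At a cone point of angle below `2π` no two
  -- directions are `π` apart.
  obtain ⟨q', hq'1, hq'2⟩ := Hyp.exists_antipode hpq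
  have e1 : H3.dist p q' = h := hq'1.trans hhh
  have e2 : H3.dist q q' = 2 * h := hq'2.trans (congrArg (2 * ·) hhh)
  have hq' : q' ∈ H3.ball p t := by
    change H3.dist p q' < t
    rw [e1]; linarith
  have d2 := hisom p hpp q' hq'
  have d3 := hisom q hq q' hq'
  rw [hfp, e1] at d2
  rw [hfq, e2] at d3
  set m := -capCos (α / 2) with hm
  have hm1 : m < 1 := by
    have := capCos_lt_of_abs_lt (s := α / 2) (t := Real.pi)
      (by rw [abs_of_pos (half_pos hα), abs_of_pos Real.pi_pos]; linarith)
      (by rw [abs_of_pos (half_pos hα)]; linarith)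
    rw [capCos_of_ge (le_abs_self _)] at this
    linarith
  have hsh := Real.sinh_pos_iff.2 hh0
  -- The distance in `N` is an infimum that need not be attained, so the lift `b` of the antipode is
  -- only within some `k > h` of `c`.
  have key : ∀ k, h < k → Real.cosh (2 * h) ≤
      Real.cosh h * Real.cosh k + max m 0 * (Real.sinh h * Real.sinh k) := by
    intro k hk
    rw [← d2] at hk
    obtain ⟨b, hb, hbk⟩ := exists_lift_of_dist_lt hk
    obtain ⟨⟨r', z', θ', hr'⟩, rfl⟩ := b.exists_mk
    have hk0 : 0 ≤ k := dist_nonneg.trans hbk.le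
    have c1 := (cosh_lt_cosh_iff dist_nonneg hk0).2 hbk
    rw [hc, Hat.cosh_dist_mk] at c1
    simp only [Real.cosh_zero, Real.sinh_zero, one_mul, zero_mul, sub_zero] at c1
    have c2 : r' < k := by
      have := Hat.radius_sub_le_dist c (HatH3.mk ⟨r', z', θ', hr'⟩)
      have h3 : c.radius = 0 := rfl
      rw [h3, Hat.radius_mk, sub_zero] at this
      exact this.trans_lt hbk
    -- A multiple of the generating rotation brings the lift to within angle `α / 2 < π` of `y`.
    set n := round ((θ - θ') / α) with hn
    have hround : |θ - (n * α + θ')| ≤ α / 2 := by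
      have h1 := abs_sub_round ((θ - θ') / α)
      rw [show θ - (n * α + θ') = ((θ - θ') / α - n) * α by field_simp; ring, abs_mul,
        abs_of_pos hα]
      nlinarith
    have hmem : (⟨0, n * α⟩ : ℂ) ∈ deckGroup α l τ := mem_deckGroup.2 ⟨n, 0, by simp, by simp⟩
    have d4 := proj_dist_le (α := α) (l := l) (τ := τ) y
      ((⟨0, n * α⟩ : ℂ) +ᵥ HatH3.mk ⟨r', z', θ', hr'⟩)
    rw [proj_eq_iff.2 ⟨_, hmem, rfl⟩, hb, d3] at d4
    have c3 := (cosh_le_cosh_iff (by positivity) dist_nonneg).2 d4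
    rw [hy, Hat.vadd_mk, Hat.cosh_dist_mk] at c3
    simp only [Cyl.shift, zero_add] at c3
    have c4 := capCos_le_of_abs_le (s := θ - (n * α + θ')) (t := α / 2)
      (by rwa [abs_of_pos (half_pos hα)])
    have s1 : 0 ≤ Real.sinh r' := Real.sinh_nonneg_iff.2 hr'
    have s2 : Real.sinh r' ≤ Real.sinh k := Real.sinh_le_sinh.2 c2.le
    have c5 : -capCos (θ - (n * α + θ')) ≤ max m 0 := le_trans (by linarith) (le_max_left _ _)
    have c6 : Real.sinh h * Real.sinh r' * -capCos (θ - (n * α + θ')) ≤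
        Real.sinh h * Real.sinh r' * max m 0 :=
      mul_le_mul_of_nonneg_left c5 (mul_nonneg hsh.le s1)
    have c7 : Real.sinh h * Real.sinh r' * max m 0 ≤ Real.sinh h * Real.sinh k * max m 0 :=
      mul_le_mul_of_nonneg_right (mul_le_mul_of_nonneg_left s2 hsh.le) (le_max_right _ _)
    have c8 : Real.cosh h * (Real.cosh r' * Real.cosh (z - z')) ≤ Real.cosh h * Real.cosh k :=
      mul_le_mul_of_nonneg_left c1.le (Real.cosh_pos h).le
    linarith
  have hcont : Continuous fun k =>
      Real.cosh h * Real.cosh k + max m 0 * (Real.sinh h * Real.sinh k) :=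
    (continuous_const.mul Real.continuous_cosh).add
      (continuous_const.mul (continuous_const.mul Real.continuous_sinh))
  have hfin := ge_of_tendsto ((hcont.tendsto h).mono_left nhdsWithin_le_nhds)
    (by filter_upwards [self_mem_nhdsWithin] with k hk using key k hk : ∀ᶠ k in
      nhdsWithin h (Set.Ioi h), _)
  rw [Real.cosh_two_mul] at hfin
  have : max m 0 < 1 := max_lt hm1 one_pos
  nlinarith [mul_pos hsh hsh]

lemma rotation_mem_deckGroup : (⟨0, α⟩ : ℂ) ∈ deckGroup α l τ :=
  mem_deckGroup.2 ⟨1, 0, by simp, by simp⟩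

lemma dist_rotation_le (β : ℝ) (x : HatH3) : dist x ((⟨0, β⟩ : ℂ) +ᵥ x) ≤ 2 * x.radius := by
  have hr : 0 ≤ x.radius := by
    obtain ⟨p, rfl⟩ := x.exists_mk
    exact p.r_nonneg
  rw [← cosh_le_cosh_iff dist_nonneg (by positivity), Hat.cosh_dist_vadd, dispCosh,
    Real.cosh_zero, Real.cosh_two_mul, Real.cosh_sq]
  nlinarith [mul_nonneg (sq_nonneg (Real.sinh x.radius))
    (by linarith [neg_one_le_capCos β] : 0 ≤ 1 + capCos β)]

/-- The generating rotation displaces `x` by at most `2 r`, so `s ≤ r`. The ball then lies in a half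
space chart, where `Ĥ³` is isometric to `ℍ³`. -/
lemma isEmbeddedBall_of_le_dist (hα : 0 < α) {x : HatH3} {s : ℝ} (hs : 0 < s)
    (h : ∀ η ∈ deckGroup α l τ, η ≠ 0 → 2 * s ≤ dist x (η +ᵥ x)) :
    (SolidTorus.proj α l τ x).IsEmbeddedBall s := by
  have hsr : s ≤ x.radius := by
    have h1 := h ⟨0, α⟩ rotation_mem_deckGroup (fun h0 => hα.ne' (congrArg Complex.im h0))
    have h2 := dist_rotation_le α x
    linarith
  obtain ⟨⟨r, z, θ, hr0⟩, rfl⟩ := x.exists_mk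
  rw [Hat.radius_mk] at hsr
  have hr : 0 < r := hs.trans_le hsr
  have hcosh : Real.cosh s ≤ Real.cosh r := (cosh_le_cosh_iff hs.le hr.le).2 hsr
  set y := Hyp.pt r z 0 with hy
  have hhalf : |(0 : ℝ)| < Real.pi / 2 := by rw [abs_zero]; positivity
  have hy2 : 0 < y.1 2 := pt_two_pos hr hhalf
  have hly : chartLift θ y = HatH3.mk ⟨r, z, θ, hr0⟩ := by
    rw [hy, chartLift_pt _ hr hhalf]
    simp
  obtain ⟨S, hSo, hSS, hS⟩ := Hyp.exists_isometry H3.origin y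
  have hpos : ∀ p, dist H3.origin p < s → 0 < (S p).1 2 := by
    intro p hp
    rw [← hS, hSo] at hp
    have h1 := (cosh_lt_cosh_iff dist_nonneg hs.le).2 hp
    rw [Hyp.dist_def, H3.cosh_dist] at h1
    -- With `w` the foot of `y` on the axis, `cosh d(y, S p) = cosh r · cosh d(w, S p) - sinh r ·
    -- x₂`. This is at least `cosh r` when `x₂ ≤ 0`.
    have h2 := H3.one_le (Hyp.pt 0 z 0) (S p)
    simp only [minkowski, hy, Hyp.pt, Matrix.cons_val, Real.cosh_zero, Real.sinh_zero,
      Real.cos_zero, Real.sin_zero] at h1 h2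
    by_contra! hneg
    have h3 := Real.sinh_pos_iff.2 hr
    nlinarith [mul_nonneg h3.le (neg_nonneg.2 hneg), Real.cosh_pos r]
  refine isMetricQuotient_proj.isEmbeddedBall (fibreSeparated_proj h)
    (j := fun p => chartLift θ (S p)) (by simp only [hSo, hly]) ?_ ?_
  · intro p q hp hq
    rw [dist_chartLift _ (hpos p hp) (hpos q hq), hS]
  · intro a ha
    obtain ⟨⟨r', z', θ', hr'⟩, rfl⟩ := a.exists_mk
    have h1 := (cosh_lt_cosh_iff dist_nonneg hs.le).2 ha
    rw [Hat.cosh_dist_mk] at h1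
    simp only at h1
    -- The same estimate in the coordinates of `Ĥ³`: the capped cosine must be positive, so the
    -- angle is below `π / 2`.
    have h2 : 0 < Real.sinh r * Real.sinh r' * capCos (θ - θ') := by
      have k1 := Real.one_le_cosh r'
      have k2 := Real.one_le_cosh (z - z')
      have k3 : Real.cosh r * 1 ≤ Real.cosh r * (Real.cosh r' * Real.cosh (z - z')) :=
        mul_le_mul_of_nonneg_left (by nlinarith) (Real.cosh_pos r).le
      linarith
    have hsr' : 0 ≤ Real.sinh r' := Real.sinh_nonneg_iff.2 hr'
    have hsr0 := Real.sinh_pos_iff.2 hr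
    have h3 : 0 < capCos (θ - θ') := pos_of_mul_pos_right h2 (mul_nonneg hsr0.le hsr')
    have h4 : 0 < r' := by
      rcases hr'.eq_or_lt with h0 | h0
      · rw [← h0] at h2
        simp at h2
      · exact h0
    have h5 : |θ' - θ| < Real.pi / 2 := by
      rw [abs_sub_comm]; exact abs_lt_of_capCos_pos h3
    have hl' : chartLift θ (Hyp.pt r' z' (θ' - θ)) = HatH3.mk ⟨r', z', θ', hr'⟩ := by
      rw [chartLift_pt _ h4 h5]
      exact HatH3.mk_eq_mk.2 ⟨rfl, rfl, Or.inr (by simp)⟩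
    refine ⟨S (Hyp.pt r' z' (θ' - θ)), ?_, by simp only [hSS, hl']⟩
    rw [← hS, hSo, hSS, ← dist_chartLift θ hy2 (pt_two_pos h4 h5), hly, hl']
    exact ha

/-- If the rotation is at least `π`, the path to `η x` runs through the core and has length at least
`2 r`, while an embedded ball has `s ≤ r`. Smaller rotations fall under the loop argument. -/
lemma isEmbeddedBall_iff_of_lt (hα : 0 < α) (hα' : α < 2 * Real.pi) (hl : 0 < l) {x : HatH3}
    (hx : 0 < x.radius) {s : ℝ} (hs : 0 < s) : (SolidTorus.proj α l τ x).IsEmbeddedBall s ↔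
      ∀ η ∈ deckGroup α l τ, η ≠ 0 → 2 * s ≤ dist x (η +ᵥ x) := by
  refine ⟨fun h η hη hne => ?_, isEmbeddedBall_of_le_dist hα hs⟩
  rcases lt_or_ge |η.im| Real.pi with him | him
  · exact dist_le_of_isEmbeddedBall_of_im_lt hα hl hx h hη hne him
  · have h1 := le_radius_of_isEmbeddedBall hα hα' h
    refine (mul_le_mul_of_nonneg_left h1 zero_le_two).trans ?_
    rw [← cosh_le_cosh_iff (by positivity) dist_nonneg, Hat.cosh_dist_vadd, dispCosh,
      capCos_of_ge him, Real.cosh_two_mul]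
    have h2 := Real.one_le_cosh η.re
    have h3 := Real.cosh_sq x.radius
    nlinarith [mul_le_mul_of_nonneg_left h2 (sq_nonneg (Real.cosh x.radius))]

/-! ### The nonsingular case: the quotient of `ℍ³` -/

/-- The map `Ĥ³ → ℍ³` given by reading cylindrical coordinates in `ℍ³`. -/
def fold (x : HatH3) : H3 :=
  Quotient.lift (s := cylSetoid) (fun p : Cyl => Hyp.pt p.r p.zeta p.theta) (by
    rintro p q ⟨h1, h2, h3⟩
    rcases h3 with h3 | h3
    · apply Subtype.ext
      simp [Hyp.pt, ← h1, ← h2, h3]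
    · simp only [h1, h2, h3]) x

lemma fold_mk (p : Cyl) : fold (HatH3.mk p) = Hyp.pt p.r p.zeta p.theta := rfl

lemma dist_fold_vadd (η : ℂ) (a b : HatH3) :
    dist (fold (η +ᵥ a)) (fold (η +ᵥ b)) = dist (fold a) (fold b) := by
  obtain ⟨p, rfl⟩ := a.exists_mk
  obtain ⟨q, rfl⟩ := b.exists_mk
  apply Hyp.dist_eq_of_minkowski
  rw [← neg_inj, Hat.vadd_mk, Hat.vadd_mk, fold_mk, fold_mk, fold_mk, fold_mk, Hyp.minkowski_pt,
    Hyp.minkowski_pt]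
  simp only [Cyl.shift, add_sub_add_left_eq_sub]

lemma capCos_le_cos (t : ℝ) : capCos t ≤ Real.cos t := by
  rcases le_total |t| Real.pi with h | h
  · rw [capCos_of_le h]
  · rw [capCos_of_ge h]; exact Real.neg_one_le_cos t

lemma dist_fold_le (a b : HatH3) : dist (fold a) (fold b) ≤ dist a b := by
  obtain ⟨p, rfl⟩ := a.exists_mk
  obtain ⟨q, rfl⟩ := b.exists_mk
  rw [← cosh_le_cosh_iff dist_nonneg dist_nonneg, Hat.cosh_dist_mk, fold_mk, fold_mk,
    Hyp.cosh_dist_pt]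
  have := mul_le_mul_of_nonneg_left (capCos_le_cos (p.theta - q.theta))
    (mul_nonneg (Real.sinh_nonneg_iff.2 p.r_nonneg) (Real.sinh_nonneg_iff.2 q.r_nonneg))
  linarith

/-- The rotation by `m` full turns. -/
def turn (m : ℤ) : ℂ := ⟨0, m * (2 * Real.pi)⟩

lemma fold_turn_vadd (m : ℤ) (a : HatH3) : fold (turn m +ᵥ a) = fold a := by
  obtain ⟨p, rfl⟩ := a.exists_mk
  rw [Hat.vadd_mk, fold_mk, fold_mk]
  apply Subtype.ext
  simp [Hyp.pt, Cyl.shift, turn, add_comm _ p.theta, Real.cos_add_int_mul_two_pi,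
    Real.sin_add_int_mul_two_pi]

/-- Rounding brings the difference of angles into `[-π, π]`, where the two distance formulas agree.
-/
lemma exists_turn_dist_eq (a b : HatH3) :
    ∃ m : ℤ, dist a (turn m +ᵥ b) = dist (fold a) (fold b) := by
  obtain ⟨p, rfl⟩ := a.exists_mk
  obtain ⟨q, rfl⟩ := b.exists_mk
  refine ⟨round ((p.theta - q.theta) / (2 * Real.pi)), ?_⟩
  set m := round ((p.theta - q.theta) / (2 * Real.pi)) with hm
  rw [← fold_turn_vadd m (HatH3.mk q)]
  have hround : |p.theta - (m * (2 * Real.pi) + q.theta)| ≤ Real.pi := by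
    have h1 := abs_sub_round ((p.theta - q.theta) / (2 * Real.pi))
    have hpi := Real.pi_pos
    rw [show p.theta - (m * (2 * Real.pi) + q.theta) =
      ((p.theta - q.theta) / (2 * Real.pi) - m) * (2 * Real.pi) by field_simp; ring, abs_mul,
      abs_of_pos (by positivity : 0 < 2 * Real.pi)]
    nlinarith
  rw [Hat.vadd_mk, Hat.dist_def, Hat.dist_mk, cylDist_of_le hround 0]
  simp only [add_zero, fold_mk]

/-- `cosh d - 1` is the sum of `cosh (r - r') - 1` and two nonnegative terms, one for each remaining
coordinate; all three vanish. -/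
lemma Hat.eq_of_dist_eq_zero {a b : HatH3} (h : dist a b = 0) : a = b := by
  obtain ⟨p, rfl⟩ := a.exists_mk
  obtain ⟨q, rfl⟩ := b.exists_mk
  have h1 := Hat.cosh_dist_mk p q
  rw [h, Real.cosh_zero] at h1
  have e1 := Real.cosh_sub p.r q.r
  have k1 := Real.one_le_cosh (p.r - q.r)
  have k2 : 0 ≤ Real.cosh p.r * Real.cosh q.r * (Real.cosh (p.zeta - q.zeta) - 1) :=
    mul_nonneg (mul_pos (Real.cosh_pos _) (Real.cosh_pos _)).le
      (sub_nonneg.2 (Real.one_le_cosh _))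
  have k3 : 0 ≤ Real.sinh p.r * Real.sinh q.r * (1 - capCos (p.theta - q.theta)) :=
    mul_nonneg (mul_nonneg (Real.sinh_nonneg_iff.2 p.r_nonneg)
      (Real.sinh_nonneg_iff.2 q.r_nonneg)) (sub_nonneg.2 (capCos_le_one _))
  have cosh_eq : ∀ {t : ℝ}, Real.cosh t = 1 → t = 0 := fun {t} ht => by
    by_contra hne
    exact (Real.one_lt_cosh.2 hne).ne' ht
  have hr : p.r = q.r := sub_eq_zero.1 (cosh_eq (by linarith))
  refine HatH3.mk_eq_mk.2 ⟨hr, ?_, ?_⟩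
  · have : Real.cosh p.r * Real.cosh q.r * (Real.cosh (p.zeta - q.zeta) - 1) = 0 := by linarith
    have := (mul_eq_zero.1 this).resolve_left (mul_pos (Real.cosh_pos _) (Real.cosh_pos _)).ne'
    exact sub_eq_zero.1 (cosh_eq (by linarith))
  · have : Real.sinh p.r * Real.sinh q.r * (1 - capCos (p.theta - q.theta)) = 0 := by linarith
    rcases mul_eq_zero.1 this with h2 | h2
    · rw [← hr, mul_self_eq_zero, Real.sinh_eq_zero] at h2
      exact Or.inl h2
    · right
      by_contra hne
      have := capCos_lt_one (sub_ne_zero.2 hne)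
      linarith

lemma exists_fold_eq (x : H3) : ∃ a, fold a = x := by
  refine ⟨HatH3.mk ⟨chartR x.1, chartZ x.1, Complex.arg ⟨x.1 2, x.1 3⟩, chartR_nonneg _⟩, ?_⟩
  have hn : ‖(⟨x.1 2, x.1 3⟩ : ℂ)‖ = √(x.1 2 ^ 2 + x.1 3 ^ 2) := by
    rw [Complex.norm_def, Complex.normSq_apply, sq, sq]
  have hc := cosh_chart x
  rw [fold_mk]
  apply Subtype.ext
  funext i
  fin_cases i
  · exact hc.1
  · exact hc.2
  · change Real.sinh (chartR x.1) * Real.cos (Complex.arg ⟨x.1 2, x.1 3⟩) = x.1 2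
    rw [chartR, Real.sinh_arsinh, ← hn, Complex.norm_mul_cos_arg]
  · change Real.sinh (chartR x.1) * Real.sin (Complex.arg ⟨x.1 2, x.1 3⟩) = x.1 3
    rw [chartR, Real.sinh_arsinh, ← hn, Complex.norm_mul_sin_arg]

/-- A right inverse of `fold`. -/
def foldInv (x : H3) : HatH3 := (exists_fold_eq x).choose

lemma fold_foldInv (x : H3) : fold (foldInv x) = x := (exists_fold_eq x).choose_spec

lemma turn_mem_deckGroup (m : ℤ) : turn m ∈ deckGroup (2 * Real.pi) l τ :=
  mem_deckGroup.2 ⟨m, 0, by simp [turn], by simp [turn]⟩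

lemma turn_add_re (m : ℤ) (η : ℂ) : (turn m + η).re = η.re := by simp [turn]

/-- The projection `ℍ³ → N` of a nonsingular torus. -/
def projH3 (l τ : ℝ) (x : H3) : SolidTorus (2 * Real.pi) l τ :=
  SolidTorus.proj (2 * Real.pi) l τ (foldInv x)

lemma projH3_fold (a : HatH3) : projH3 l τ (fold a) = SolidTorus.proj (2 * Real.pi) l τ a := by
  obtain ⟨m, hm⟩ := exists_turn_dist_eq a (foldInv (fold a))
  rw [fold_foldInv, dist_self] at hm
  exact (proj_eq_iff.2 ⟨turn m, turn_mem_deckGroup m, (Hat.eq_of_dist_eq_zero hm).symm⟩).symm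

lemma isMetricQuotient_projH3 : IsMetricQuotient (projH3 l τ) where
  dist_le x y := by
    obtain ⟨a, rfl⟩ := exists_fold_eq x
    obtain ⟨b, rfl⟩ := exists_fold_eq y
    obtain ⟨m, hm⟩ := exists_turn_dist_eq a b
    rw [← hm, ← fold_turn_vadd m b, projH3_fold, projH3_fold]
    exact proj_dist_le _ _
  exists_lift x y t h := by
    obtain ⟨b, rfl, hb⟩ := exists_lift_of_dist_lt h
    refine ⟨fold b, projH3_fold b, lt_of_le_of_lt ?_ hb⟩
    have := dist_fold_le (foldInv x) b
    rwa [fold_foldInv] at this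

lemma le_dist_fold {x : HatH3} {s : ℝ}
    (h : ∀ η ∈ deckGroup (2 * Real.pi) l τ, η.re ≠ 0 → s ≤ dist x (η +ᵥ x)) {η : ℂ}
    (hη : η ∈ deckGroup (2 * Real.pi) l τ) (hre : η.re ≠ 0) :
    s ≤ dist (fold x) (fold (η +ᵥ x)) := by
  obtain ⟨m, hm⟩ := exists_turn_dist_eq x (η +ᵥ x)
  rw [← hm, vadd_vadd]
  exact h _ (add_mem (turn_mem_deckGroup m) hη) (by rwa [turn_add_re])

lemma eq_turn_of_re_eq_zero (hl : 0 < l) {η : ℂ} (hη : η ∈ deckGroup (2 * Real.pi) l τ)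
    (h : η.re = 0) : ∃ m, η = turn m := by
  obtain ⟨m, k, h1, h2⟩ := mem_deckGroup.1 hη
  rw [h] at h1
  have hk : (k : ℝ) = 0 := (mul_eq_zero.1 h1.symm).resolve_right hl.ne'
  exact ⟨m, Complex.ext (by simp [h, turn]) (by simp [h2, hk, turn])⟩

/-- An element relating lifts of distinct points of `ℍ³` is not a full turn, so it translates. From
there the argument is that of `fibreSeparated_proj`. -/
lemma fibreSeparated_projH3 (hl : 0 < l) {x : HatH3} {s : ℝ}
    (h : ∀ η ∈ deckGroup (2 * Real.pi) l τ, η.re ≠ 0 → 2 * s ≤ dist x (η +ᵥ x)) :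
    FibreSeparated (projH3 l τ) (fold x) s := by
  intro b b' hb hne
  obtain ⟨η, hη, h1⟩ := proj_eq_iff.1 hb
  have h2 : fold (η +ᵥ foldInv b') = b := by rw [h1, fold_foldInv]
  have hre : η.re ≠ 0 := by
    intro h0
    obtain ⟨m, rfl⟩ := eq_turn_of_re_eq_zero hl hη h0
    rw [fold_turn_vadd, fold_foldInv] at h2
    exact hne h2.symm
  have h3 := le_dist_fold h hη hre
  have h4 := dist_triangle (fold x) b (fold (η +ᵥ x))
  have h5 := dist_fold_vadd η (foldInv b') x
  rw [fold_foldInv, h2, dist_comm b' (fold x)] at h5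
  linarith

/-- Here the core is not singular, so both directions are carried out in `ℍ³`. Translating elements
displace every point by at least `l`, which gives separation by `l / 2` along the whole loop. -/
lemma isEmbeddedBall_iff_two_pi (hl : 0 < l) {x : HatH3} {s : ℝ} :
    (SolidTorus.proj (2 * Real.pi) l τ x).IsEmbeddedBall s ↔
      ∀ η ∈ deckGroup (2 * Real.pi) l τ, η.re ≠ 0 → 2 * s ≤ dist x (η +ᵥ x) := by
  rw [← projH3_fold]
  constructor
  · intro h η hη hre
    refine le_trans ?_ (dist_fold_le x (η +ᵥ x))
    have hd : 0 < dist (fold x) (fold (η +ᵥ x)) :=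
      hl.trans_le (le_dist_fold (fun η hη h => le_dist_vadd_of_re_ne_zero hl x hη h) hη hre)
    obtain ⟨e, he, hae, hend, -⟩ := Hyp.exists_geo (dist_pos.1 hd)
    refine isMetricQuotient_projH3.le_of_isEmbeddedBall (π := projH3 l τ)
      (c := fun u => Hyp.geo (fold x) e he hae u) hd ?_ ?_ ?_ ?_
    · intro u _ u' _
      exact Hyp.dist_geo _ _ _ _ _ _
    · simp only [hend, Hyp.geo_zero, projH3_fold]
      exact (proj_eq_iff.2 ⟨η, hη, rfl⟩).symm
    · intro u _
      refine ⟨l / 2, half_pos hl, ?_⟩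
      rw [← fold_foldInv (Hyp.geo (fold x) e he hae u)]
      refine fibreSeparated_projH3 hl fun η hη h => ?_
      rw [mul_div_cancel₀ _ two_ne_zero]
      exact le_dist_vadd_of_re_ne_zero hl _ hη h
    · simp only [Hyp.geo_zero]
      exact h
  · intro h
    obtain ⟨S, hSo, hSS, hS⟩ := Hyp.exists_isometry H3.origin (fold x)
    refine isMetricQuotient_projH3.isEmbeddedBall (fibreSeparated_projH3 hl h) hSo
      (fun p q _ _ => hS p q) fun a ha => ⟨S a, ?_, hSS a⟩
    rw [← hS, hSo, hSS]
    exact ha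

/-! ### The injectivity radius -/

/-- The elements of the deck group which act without fixed points and nontrivially away from a
singular core. -/
def effective (α l τ : ℝ) : Set ℂ :=
  {η | η ∈ deckGroup α l τ ∧ η ≠ 0 ∧ (α = 2 * Real.pi → η.re ≠ 0)}

lemma isEmbeddedBall_iff (hα : 0 < α) (hα' : α ≤ 2 * Real.pi) (hl : 0 < l) {x : HatH3}
    (hx : α = 2 * Real.pi ∨ 0 < x.radius) {s : ℝ} (hs : 0 < s) :
    (SolidTorus.proj α l τ x).IsEmbeddedBall s ↔
      ∀ η ∈ effective α l τ, 2 * s ≤ dist x (η +ᵥ x) := by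
  by_cases h : α = 2 * Real.pi
  · subst h
    rw [isEmbeddedBall_iff_two_pi hl]
    refine ⟨fun H η hη => H η hη.1 (hη.2.2 rfl), fun H η hη hre => H η ⟨hη, ?_, fun _ => hre⟩⟩
    rintro rfl
    exact hre rfl
  · rw [isEmbeddedBall_iff_of_lt hα (lt_of_le_of_ne hα' h) hl (hx.resolve_left h) hs]
    exact ⟨fun H η hη => H η hη.1 hη.2.1, fun H η hη hne => H η ⟨hη, hne, fun h' => absurd h' h⟩⟩

lemma injrad_proj (hα : 0 < α) (hα' : α ≤ 2 * Real.pi) (hl : 0 < l) {x : HatH3}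
    (hx : α = 2 * Real.pi ∨ 0 < x.radius) : (SolidTorus.proj α l τ x).injrad =
      sSup {s : ℝ | 0 < s ∧ ∀ η ∈ effective α l τ, 2 * s ≤ dist x (η +ᵥ x)} := by
  have h : ¬ (α ≠ 2 * Real.pi ∧ (SolidTorus.proj α l τ x).radius = 0) := by
    rintro ⟨h1, h2⟩
    exact (hx.resolve_left h1).ne' h2
  rw [SolidTorus.injrad, if_neg h]
  congr 1
  ext s
  exact and_congr_right fun hs => isEmbeddedBall_iff hα hα' hl hx hs

lemma injrad_le (hα : 0 < α) (hα' : α ≤ 2 * Real.pi) (hl : 0 < l) {x : HatH3}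
    (hx : α = 2 * Real.pi ∨ 0 < x.radius) {η : ℂ} (hη : η ∈ effective α l τ) :
    (SolidTorus.proj α l τ x).injrad ≤ dist x (η +ᵥ x) / 2 := by
  rw [injrad_proj hα hα' hl hx]
  -- The bound must also be nonnegative, since the supremum of an empty set is `0`.
  refine Real.sSup_le (fun s hs => ?_) (div_nonneg dist_nonneg zero_le_two)
  have := hs.2 η hη
  linarith

lemma translation_mem_effective (hl : 0 < l) : (⟨l, τ⟩ : ℂ) ∈ effective α l τ :=
  ⟨mem_deckGroup.2 ⟨0, 1, by simp, by simp⟩, fun h => hl.ne' (congrArg Complex.re h),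
    fun _ => hl.ne'⟩

lemma le_injrad (hα : 0 < α) (hα' : α ≤ 2 * Real.pi) (hl : 0 < l) {x : HatH3}
    (hx : α = 2 * Real.pi ∨ 0 < x.radius) {s : ℝ} (hs : 0 < s)
    (h : ∀ η ∈ effective α l τ, s ≤ dist x (η +ᵥ x)) :
    s / 2 ≤ (SolidTorus.proj α l τ x).injrad := by
  rw [injrad_proj hα hα' hl hx]
  refine le_csSup ⟨dist x ((⟨l, τ⟩ : ℂ) +ᵥ x) / 2, fun t ht => ?_⟩ ⟨half_pos hs, fun η hη => ?_⟩
  · have := ht.2 _ (translation_mem_effective hl)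
    linarith
  · rw [mul_div_cancel₀ _ two_ne_zero]
    exact h η hη

/-! ### Affine displacement functions -/

/-- The hyperbolic cosine of the displacement of `η`, as an affine function of `X = cosh² r`. -/
def dispAff (η : ℂ) (X : ℝ) : ℝ := X * (Real.cosh η.re - capCos η.im) + capCos η.im

lemma dispCosh_eq (η : ℂ) (r : ℝ) : dispCosh η r = dispAff η (Real.cosh r ^ 2) := rfl

lemma dispAff_slope_pos {η : ℂ} (hη : η ≠ 0) : 0 < Real.cosh η.re - capCos η.im := by
  by_cases h : η.re = 0
  · have him : η.im ≠ 0 := fun h' => hη (Complex.ext h h')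
    have := capCos_lt_one him
    rw [h, Real.cosh_zero]
    linarith
  · have := Real.one_lt_cosh.2 h
    have := capCos_le_one η.im
    linarith

lemma dispAff_le {η η' : ℂ} (hre : η.re = η'.re) (him : |η.im| ≤ |η'.im|) {X : ℝ} (hX : 1 ≤ X) :
    dispAff η X ≤ dispAff η' X := by
  have := capCos_le_of_abs_le him
  rw [dispAff, dispAff, hre]
  nlinarith

/-- For `k ≠ 0`, the element of the deck group with translation length `k l` of least rotation;
for `k = 0`, the generating rotation. -/
def leastElement (α l τ : ℝ) (k : ℤ) : ℂ :=
  if k = 0 then ⟨0, α⟩ else ⟨k * l, k * τ - round (k * τ / α) * α⟩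

/-- The indices of effective elements. -/
def effectiveIndex (α : ℝ) : Set ℤ := {k | α = 2 * Real.pi → k ≠ 0}

lemma leastElement_re (k : ℤ) : (leastElement α l τ k).re = k * l := by
  unfold leastElement
  split_ifs with h
  · simp [h]
  · rfl

lemma leastElement_mem (hα : 0 < α) (hl : 0 < l) {k : ℤ} (hk : k ∈ effectiveIndex α) :
    leastElement α l τ k ∈ effective α l τ := by
  by_cases h : k = 0
  · rw [leastElement, if_pos h]
    exact ⟨rotation_mem_deckGroup, fun h0 => hα.ne' (congrArg Complex.im h0),
      fun h' => absurd h (hk h')⟩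
  · have hre : (leastElement α l τ k).re ≠ 0 := by
      rw [leastElement_re]
      exact mul_ne_zero (by exact_mod_cast h) hl.ne'
    refine ⟨mem_deckGroup.2 ⟨-round (k * τ / α), k, leastElement_re k, ?_⟩,
      fun h0 => hre (congrArg Complex.re h0), fun _ => hre⟩
    rw [leastElement, if_neg h]
    push_cast
    ring

/-- Displacement grows with `|Im η|` for fixed `Re η`. One element per translation length, with the
least rotation, therefore suffices, which leaves a family indexed by `ℤ`. -/
lemma exists_leastElement_le (hα : 0 < α) (hl : 0 < l) {η : ℂ} (hη : η ∈ effective α l τ) :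
    ∃ k ∈ effectiveIndex α, (leastElement α l τ k).re = η.re ∧
      |(leastElement α l τ k).im| ≤ |η.im| := by
  obtain ⟨m, k, h1, h2⟩ := mem_deckGroup.1 hη.1
  refine ⟨k, fun h => ?_, by rw [leastElement_re, h1], ?_⟩
  · rintro rfl
    exact hη.2.2 h (by simpa using h1)
  · by_cases h : k = 0
    · rw [leastElement, if_pos h]
      subst h
      simp only [Int.cast_zero, zero_mul] at h1
      simpa only [abs_of_pos hα] using abs_im_of_mem_deckGroup hα hl hη.1 hη.2.1 h1
    · rw [leastElement, if_neg h, h2]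
      have h3 := round_le (k * τ / α) (-m)
      rw [← mul_le_mul_iff_left₀ (abs_pos.2 hα.ne'), ← abs_mul, ← abs_mul] at h3
      rw [show (k * τ / α - round (k * τ / α)) * α = k * τ - round (k * τ / α) * α by field_simp,
        show (k * τ / α - (-m : ℤ)) * α = m * α + k * τ by push_cast; field_simp; ring] at h3
      exact h3

/-- There is a critical value of `cosh² r` at which the least displacement is `C`. -/
lemma exists_critical (hα : 0 < α) (hl : 0 < l) {C : ℝ} (hC : 1 < C) :
    ∃ X > 0, (∀ k ∈ effectiveIndex α, C ≤ dispAff (leastElement α l τ k) X) ∧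
      ∃ k ∈ effectiveIndex α, dispAff (leastElement α l τ k) X = C := by
  set a : ℤ → ℝ := fun k => Real.cosh (leastElement α l τ k).re with ha
  set c : ℤ → ℝ := fun k => capCos (leastElement α l τ k).im with hc
  -- `Q k` is the value of `X` at which the displacement of the `k`-th element has hyperbolic cosine
  -- `C`. The critical `X` is the maximum of `Q`.
  set Q : ℤ → ℝ := fun k => (C - c k) / (a k - c k) with hQ
  have hslope : ∀ k ∈ effectiveIndex α, 0 < a k - c k := fun k hk =>
    dispAff_slope_pos (leastElement_mem hα hl hk).2.1
  have hnum : ∀ k, 0 < C - c k := fun k => by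
    have : c k ≤ 1 := capCos_le_one _
    linarith
  have hQpos : ∀ k ∈ effectiveIndex α, 0 < Q k := fun k hk => div_pos (hnum k) (hslope k hk)
  have h1 : (1 : ℤ) ∈ effectiveIndex α := fun _ => one_ne_zero
  -- The maximum exists because `cosh (k l)` is unbounded in `k`: only finitely many `Q k` reach `Q
  -- 1`. The index `1` is always effective.
  set S : Set ℤ := {k | k ∈ effectiveIndex α ∧ Q 1 ≤ Q k} with hS
  set B := 1 + (C + 1) / Q 1 with hB
  have hB1 : 1 ≤ B := by
    have : 0 < (C + 1) / Q 1 := div_pos (by linarith) (hQpos 1 h1)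
    linarith
  have hfin : S.Finite := by
    refine (Set.finite_Icc (-⌈Real.arcosh B / l⌉) ⌈Real.arcosh B / l⌉).subset ?_
    rintro k ⟨hk, hle⟩
    have e1 : Q 1 * (a k - c k) ≤ C - c k := by
      rwa [hQ, le_div_iff₀ (hslope k hk)] at hle
    have e2 : c k ≤ 1 := capCos_le_one _
    have e3 : -1 ≤ c k := neg_one_le_capCos _
    have e4 : a k - c k ≤ (C + 1) / Q 1 := by
      rw [le_div_iff₀ (hQpos 1 h1)]
      linarith
    have e5 : Real.cosh |(k : ℝ) * l| ≤ Real.cosh (Real.arcosh B) := by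
      rw [Real.cosh_arcosh hB1, Real.cosh_abs, ← leastElement_re (α := α) (τ := τ)]
      change a k ≤ B
      linarith
    rw [cosh_le_cosh_iff (abs_nonneg _) (Real.arcosh_nonneg hB1), abs_mul, abs_of_pos hl,
      ← le_div_iff₀ hl] at e5
    have e6 := abs_le.1 (e5.trans (Int.le_ceil _))
    exact ⟨by exact_mod_cast e6.1, by exact_mod_cast e6.2⟩
  obtain ⟨k, ⟨hk, hk1⟩, hmax⟩ := Set.exists_max_image S Q hfin ⟨1, h1, le_rfl⟩
  refine ⟨Q k, hQpos k hk, fun j hj => ?_, k, hk, ?_⟩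
  · have : Q j ≤ Q k := by
      by_cases h : Q 1 ≤ Q j
      · exact hmax j ⟨hj, h⟩
      · exact (not_le.1 h).le.trans hk1
    have h2 : (C - c j) / (a j - c j) ≤ Q k := this
    rw [div_le_iff₀ (hslope j hj)] at h2
    change C ≤ Q k * (a j - c j) + c j
    linarith
  · change (C - c k) / (a k - c k) * (a k - c k) + c k = C
    rw [div_mul_cancel₀ _ (hslope k hk).ne']
    ring

/-- Strictness over infinitely many elements needs a uniform gap. Since `c ≤ 1`, all slopes are at
least `(cosh δ - 1) / X`, so beyond `X` every displacement exceeds `δ` by a common margin. -/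
lemma half_lt_injrad (hα : 0 < α) (hα' : α ≤ 2 * Real.pi) (hl : 0 < l) {x : HatH3}
    (hx : α = 2 * Real.pi ∨ 0 < x.radius) {δ X : ℝ} (hδ : 0 < δ) (hX : 0 < X)
    (hk : ∀ k ∈ effectiveIndex α, Real.cosh δ ≤ dispAff (leastElement α l τ k) X)
    (hlt : X < Real.cosh x.radius ^ 2) : δ / 2 < (SolidTorus.proj α l τ x).injrad := by
  have hC := Real.one_lt_cosh.2 hδ.ne'
  set g := (Real.cosh δ - 1) / X * (Real.cosh x.radius ^ 2 - X) with hg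
  have hg0 : 0 < g := mul_pos (div_pos (by linarith) hX) (by linarith)
  have h1 : δ < Real.arcosh (Real.cosh δ + g) := by
    rw [← cosh_lt_cosh_iff hδ.le (Real.arcosh_nonneg (by linarith)),
      Real.cosh_arcosh (by linarith)]
    linarith
  refine lt_of_lt_of_le (by linarith) (le_injrad hα hα' hl hx (hδ.trans h1) fun η hη => ?_)
  rw [← cosh_le_cosh_iff (Real.arcosh_nonneg (by linarith)) dist_nonneg,
    Real.cosh_arcosh (by linarith), Hat.cosh_dist_vadd, dispCosh_eq]
  obtain ⟨k, hkm, hre, him⟩ := exists_leastElement_le hα hl hη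
  refine le_trans ?_ (dispAff_le hre him (one_le_pow₀ (Real.one_le_cosh _)))
  have h2 := hk k hkm
  set A := Real.cosh (leastElement α l τ k).re - capCos (leastElement α l τ k).im with hA
  have h3 : (Real.cosh δ - 1) / X ≤ A := by
    rw [div_le_iff₀ hX]
    have := capCos_le_one (leastElement α l τ k).im
    rw [dispAff, ← hA] at h2
    linarith
  have h4 := mul_le_mul_of_nonneg_right h3 (sub_nonneg.2 hlt.le)
  rw [dispAff, ← hA] at h2 ⊢
  linarith

/-- The thin torus is an equidistant torus, at the distance where the least displacement is `δ`. -/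
lemma exists_radius (hα : 0 < α) (hα' : α ≤ 2 * Real.pi) (hl : 0 < l) {δ : ℝ} (hδ : 0 < δ)
    (hthin : (thinPart α l τ δ).Nonempty) :
    ∃ ρ, 0 ≤ ρ ∧ thinTorus α l τ δ = equidistantTorus α l τ ρ ∧ tubeRadius α l τ δ = ρ ∧
      (∃ η ∈ effective α l τ, dispCosh η ρ = Real.cosh δ) ∧
      ∀ η ∈ effective α l τ, Real.cosh δ ≤ dispCosh η ρ := by
  have hC := Real.one_lt_cosh.2 hδ.ne'
  obtain ⟨X, hX0, hall, k, hk, hkX⟩ := exists_critical (τ := τ) hα hl hC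
  -- In the singular case the rotation by `α` is effective. It fixes the core, that is, has
  -- displacement zero at `X = 1`.
  have hXrot : α ≠ 2 * Real.pi → 1 < X := by
    intro hne
    have h1 := hall 0 fun h => absurd h hne
    have h2 := capCos_lt_one hα.ne'
    rw [dispAff, leastElement, if_pos rfl, Real.cosh_zero] at h1
    simp only at h1
    by_contra! hle
    nlinarith
  -- If `X < 1`, every point would have injectivity radius above `δ / 2`, and the thin part would be
  -- empty.
  have hX1 : 1 ≤ X := by
    by_contra! hlt
    have h2π : α = 2 * Real.pi := by
      by_contra hne
      exact absurd (hXrot hne) (not_lt.2 hlt.le)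
    obtain ⟨y, hy⟩ := hthin
    obtain ⟨x, rfl⟩ := exists_proj y
    have := half_lt_injrad hα hα' hl (Or.inl h2π) hδ hX0 hall (x := x)
      (hlt.trans_le (one_le_pow₀ (Real.one_le_cosh _)))
    exact absurd hy (not_le.2 this)
  have hsX : 1 ≤ Real.sqrt X := Real.one_le_sqrt.2 hX1
  set ρ := Real.arcosh (Real.sqrt X) with hρ
  have hρ0 : 0 ≤ ρ := Real.arcosh_nonneg hsX
  have hcosh : Real.cosh ρ ^ 2 = X := by
    rw [hρ, Real.cosh_arcosh hsX, Real.sq_sqrt hX0.le]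
  have hρ1 : α = 2 * Real.pi ∨ 0 < ρ := by
    by_cases h : α = 2 * Real.pi
    · exact Or.inl h
    · right
      have h1 := hXrot h
      refine lt_of_le_of_ne hρ0 fun h0 => ?_
      rw [← hcosh, ← h0, Real.cosh_zero] at h1
      norm_num at h1
  have hmem := leastElement_mem (τ := τ) hα hl hk
  have hη1 : dispCosh (leastElement α l τ k) ρ = Real.cosh δ := by
    rw [dispCosh_eq, hcosh, hkX]
  have hη2 : ∀ η ∈ effective α l τ, Real.cosh δ ≤ dispCosh η ρ := by
    intro η hη
    obtain ⟨j, hj, hre, him⟩ := exists_leastElement_le hα hl hη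
    rw [dispCosh_eq, hcosh]
    exact (hall j hj).trans (dispAff_le hre him hX1)
  have htorus : thinTorus α l τ δ = equidistantTorus α l τ ρ := by
    ext y
    obtain ⟨x, rfl⟩ := exists_proj y
    have hx0 : 0 ≤ x.radius := by
      obtain ⟨p, rfl⟩ := x.exists_mk
      exact p.r_nonneg
    constructor
    · intro hy
      have hy' : (SolidTorus.proj α l τ x).injrad = δ / 2 := hy
      have hx : α = 2 * Real.pi ∨ 0 < x.radius := by
        by_contra! hne
        have h0 : x.radius = 0 := le_antisymm hne.2 hx0
        rw [SolidTorus.injrad, if_pos ⟨hne.1, h0⟩] at hy'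
        linarith
      change x.radius = ρ
      -- Nearer the core the critical element moves points by less than `δ`; farther out the uniform
      -- gap applies.
      rcases lt_trichotomy x.radius ρ with hlt | heq | hgt
      · exfalso
        have h1 := injrad_le hα hα' hl hx hmem
        have h2 : Real.cosh (dist x (leastElement α l τ k +ᵥ x)) < Real.cosh δ := by
          rw [Hat.cosh_dist_vadd, ← hη1, dispCosh, dispCosh]
          have h3 := (cosh_lt_cosh_iff hx0 hρ0).2 hlt
          have h4 := dispAff_slope_pos hmem.2.1
          have h5 : Real.cosh x.radius ^ 2 < Real.cosh ρ ^ 2 :=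
            pow_lt_pow_left₀ h3 (Real.cosh_pos _).le two_ne_zero
          have h6 := mul_lt_mul_of_pos_right h5 h4
          linarith
        rw [cosh_lt_cosh_iff dist_nonneg hδ.le] at h2
        linarith
      · exact heq
      · exfalso
        have h3 := (cosh_lt_cosh_iff hρ0 hx0).2 hgt
        have h5 : Real.cosh ρ ^ 2 < Real.cosh x.radius ^ 2 :=
          pow_lt_pow_left₀ h3 (Real.cosh_pos _).le two_ne_zero
        rw [hcosh] at h5
        have := half_lt_injrad hα hα' hl hx hδ hX0 hall h5
        linarith
    · intro hy
      have hy' : x.radius = ρ := hy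
      have hx : α = 2 * Real.pi ∨ 0 < x.radius := by rwa [hy']
      apply le_antisymm
      · refine (injrad_le hα hα' hl hx hmem).trans ?_
        have h2 : Real.cosh (dist x (leastElement α l τ k +ᵥ x)) ≤ Real.cosh δ := by
          rw [Hat.cosh_dist_vadd, hy', hη1]
        rw [cosh_le_cosh_iff dist_nonneg hδ.le] at h2
        linarith
      · refine le_injrad hα hα' hl hx hδ fun η hη => ?_
        rw [← cosh_le_cosh_iff hδ.le dist_nonneg, Hat.cosh_dist_vadd, hy']
        exact hη2 η hη
  refine ⟨ρ, hρ0, htorus, ?_, ⟨_, hmem, hη1⟩, hη2⟩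
  have himage : SolidTorus.radius '' thinTorus α l τ δ = {ρ} := by
    rw [htorus]
    ext r
    constructor
    · rintro ⟨y, hy, rfl⟩
      exact hy
    · intro hr
      have hr' : r = ρ := hr
      exact ⟨SolidTorus.proj α l τ (HatH3.mk ⟨ρ, 0, 0, hρ0⟩), rfl, hr'.symm⟩
  rw [tubeRadius, himage, csSup_singleton]

lemma eq_zero_of_capCos_eq_one {t : ℝ} (h : capCos t = 1) : t = 0 := by
  by_contra hne
  exact (capCos_lt_one hne).ne h

end

end ModelTube

/-! ### The inequality and its equality case -/

theorem proposition5p3 (α l τ δ ε : ℝ) (hα : 0 < α) (hα' : α ≤ 2 * Real.pi) (hl : 0 < l)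
    (hδ : 0 < δ) (hδε : δ < ε) (hthin : (ModelTube.thinPart α l τ δ).Nonempty) :
    -- the tube radii are well defined
    ModelTube.thinTorus α l τ δ
      = ModelTube.equidistantTorus α l τ (ModelTube.tubeRadius α l τ δ) ∧
    ModelTube.thinTorus α l τ ε
      = ModelTube.equidistantTorus α l τ (ModelTube.tubeRadius α l τ ε) ∧
    -- the inequality
    Real.cosh (ModelTube.tubeRadius α l τ ε) / Real.cosh (ModelTube.tubeRadius α l τ δ)
      ≤ Real.sqrt ((Real.cosh ε - 1) / (Real.cosh δ - 1)) ∧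
    -- the equality case
    (Real.cosh (ModelTube.tubeRadius α l τ ε) / Real.cosh (ModelTube.tubeRadius α l τ δ)
        = Real.sqrt ((Real.cosh ε - 1) / (Real.cosh δ - 1)) ↔
      ∃ η ∈ ModelTube.deckGroup α l τ,
        ModelTube.IsLoxodromic η ∧ ModelTube.HasTrivialRotation η ∧
        ModelTube.RealizesInjrad α l τ η (ModelTube.thinTorus α l τ δ) ∧
        ModelTube.RealizesInjrad α l τ η (ModelTube.thinTorus α l τ ε)) ∧
    (α = 2 * Real.pi → τ = 0 →
      Real.cosh (ModelTube.tubeRadius α l τ ε) / Real.cosh (ModelTube.tubeRadius α l τ δ)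
        = Real.sqrt ((Real.cosh ε - 1) / (Real.cosh δ - 1))) := by
  open ModelTube in
  have hε : 0 < ε := hδ.trans hδε
  obtain ⟨ρ, hρ0, ht1, hr1, ⟨η₁, hη₁, e₁⟩, hall₁⟩ := exists_radius hα hα' hl hδ hthin
  have hthin' : (thinPart α l τ ε).Nonempty := by
    obtain ⟨x, hx⟩ := hthin
    have hx' : x.injrad ≤ δ / 2 := hx
    exact ⟨x, hx'.trans (by linarith)⟩
  obtain ⟨σ, hσ0, ht2, hr2, ⟨η₂, hη₂, e₂⟩, hall₂⟩ := exists_radius hα hα' hl hε hthin'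
  have hCδ := Real.one_lt_cosh.2 hδ.ne'
  have hCε : Real.cosh δ < Real.cosh ε := (cosh_lt_cosh_iff hδ.le hε.le).2 hδε
  have hρc := Real.cosh_pos ρ
  have hσc := Real.cosh_pos σ
  have hrat : 0 ≤ (Real.cosh ε - 1) / (Real.cosh δ - 1) :=
    div_nonneg (by linarith) (by linarith)
  have hsq : 0 ≤ Real.cosh σ / Real.cosh ρ := (div_pos hσc hρc).le
  -- The element realizing `ε` is compared at the smaller level `δ`.
  have hle := hall₁ η₂ hη₂
  have hA := dispAff_slope_pos hη₂.2.1
  have hc1 := capCos_le_one η₂.im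
  have hX : 0 < Real.cosh ρ ^ 2 := by positivity
  rw [dispCosh] at e₂ hle
  have hreal : ∀ η ∈ deckGroup α l τ, η.im = 0 → dispCosh η ρ = Real.cosh δ →
      dispCosh η σ = Real.cosh ε →
      Real.cosh σ / Real.cosh ρ = Real.sqrt ((Real.cosh ε - 1) / (Real.cosh δ - 1)) := by
    intro η _ him h1 h2
    rw [dispCosh, him, capCos_zero] at h1 h2
    have hA' : Real.cosh η.re - 1 ≠ 0 := by
      intro h0
      rw [h0] at h1
      linarith
    rw [← h1, ← h2, add_sub_cancel_right, add_sub_cancel_right, mul_div_mul_right _ _ hA',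
      ← div_pow, Real.sqrt_sq hsq]
  rw [hr1, hr2]
  refine ⟨ht1, ht2, ?_, ⟨?_, ?_⟩, ?_⟩
  · apply Real.le_sqrt_of_sq_le
    rw [div_pow, div_le_div_iff₀ hX (by linarith)]
    -- With `c = capCos η₂.im` and `A` the slope, `cosh² σ (cosh δ - c) ≤ cosh² σ cosh² ρ A = cosh²
    -- ρ (cosh ε - c)`. Moreover `(cosh ε - c)(cosh δ - 1) ≤ (cosh ε - 1)(cosh δ - c)`, the
    -- difference being `(cosh ε - cosh δ)(1 - c)`.
    nlinarith
  · intro heq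
    have h1 : Real.cosh σ ^ 2 * (Real.cosh δ - 1) = (Real.cosh ε - 1) * Real.cosh ρ ^ 2 := by
      have := congrArg (· ^ 2) heq
      simp only [Real.sq_sqrt hrat, div_pow] at this
      rwa [div_eq_div_iff hX.ne' (by linarith : Real.cosh δ - 1 ≠ 0)] at this
    have hXlt : Real.cosh ρ ^ 2 < Real.cosh σ ^ 2 := by
      by_contra! hge
      nlinarith
    -- The two sides of `h1` differ by at least `(1 - c)(cosh² σ - cosh² ρ)`, so equality forces `c
    -- = 1`.
    have hc : capCos η₂.im = 1 := by
      by_contra hne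
      have hlt : capCos η₂.im < 1 := lt_of_le_of_ne hc1 hne
      have hX' : 0 < Real.cosh σ ^ 2 := by positivity
      have h2 := mul_le_mul_of_nonneg_left hle hX'.le
      nlinarith [mul_pos (sub_pos.2 hXlt) (sub_pos.2 hlt)]
    have him := eq_zero_of_capCos_eq_one hc
    have hσ2 : dispCosh η₂ σ = Real.cosh ε := e₂
    have hρ2 : dispCosh η₂ ρ = Real.cosh δ := by
      have hX' : Real.cosh σ ^ 2 ≠ 0 := by positivity
      rw [dispCosh]
      rw [hc] at e₂ ⊢
      apply mul_left_cancel₀ hX'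
      linear_combination Real.cosh ρ ^ 2 * e₂ - h1
    have hrealizes : ∀ (ω r : ℝ), 0 ≤ ω → thinTorus α l τ ω = equidistantTorus α l τ r →
        dispCosh η₂ r = Real.cosh ω → RealizesInjrad α l τ η₂ (thinTorus α l τ ω) := by
      intro ω r hω ht hd a ha
      have h3 : (SolidTorus.proj α l τ a).injrad = ω / 2 := ha
      rw [ht] at ha
      have h4 : a.radius = r := ha
      rw [h3, mul_div_cancel₀ _ two_ne_zero, ← Hat.dist_def]
      apply Real.cosh_injOn (Set.mem_Ici.2 dist_nonneg) (Set.mem_Ici.2 hω)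
      rw [Hat.cosh_dist_vadd, h4, hd]
    exact ⟨η₂, hη₂.1, fun hre => hη₂.2.1 (Complex.ext hre him), him,
      hrealizes δ ρ hδ.le ht1 hρ2, hrealizes ε σ hε.le ht2 hσ2⟩
  · rintro ⟨η, hη, -, him, hre1, hre2⟩
    have h1 : ∀ (ω r : ℝ) (hr : 0 ≤ r), thinTorus α l τ ω = equidistantTorus α l τ r →
        RealizesInjrad α l τ η (thinTorus α l τ ω) → dispCosh η r = Real.cosh ω := by
      intro ω r hr ht hreal'
      have hm : SolidTorus.proj α l τ (HatH3.mk ⟨r, 0, 0, hr⟩) ∈ thinTorus α l τ ω := by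
        rw [ht]
        rfl
      have h2 := hreal' _ hm
      have h3 : (SolidTorus.proj α l τ (HatH3.mk ⟨r, 0, 0, hr⟩)).injrad = ω / 2 := hm
      rw [h3, mul_div_cancel₀ _ two_ne_zero, ← Hat.dist_def] at h2
      rw [← h2, Hat.cosh_dist_vadd]
      rfl
    exact hreal η hη him (h1 δ ρ hρ0 ht1 hre1) (h1 ε σ hσ0 ht2 hre2)
  · intro h2π hτ
    have hmem := translation_mem_effective (α := α) (τ := τ) hl
    -- The displacement is `X cosh (Re η) - (X - 1) c` with `X ≥ 1`. It is least when `|Re η| = l`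
    -- and `c = 1`, which the pure translation attains at every radius.
    have hmin : ∀ η ∈ effective α l τ, ∀ r, dispCosh ⟨l, τ⟩ r ≤ dispCosh η r := by
      intro η hη r
      have h1 := abs_re_of_mem_deckGroup hl hη.1 (hη.2.2 h2π)
      have h2 : Real.cosh l ≤ Real.cosh η.re := by
        rwa [← Real.cosh_abs η.re, cosh_le_cosh_iff hl.le (abs_nonneg _)]
      have h3 := capCos_le_one η.im
      have h4 : 1 ≤ Real.cosh r ^ 2 := one_le_pow₀ (Real.one_le_cosh r)
      rw [dispCosh, dispCosh, hτ, capCos_zero]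
      nlinarith
    exact hreal ⟨l, τ⟩ hmem.1 hτ
      (le_antisymm ((hmin η₁ hη₁ ρ).trans e₁.le) (hall₁ _ hmem))
      (le_antisymm ((hmin η₂ hη₂ σ).trans e₂.le) (hall₂ _ hmem))
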